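/- Let $\lambda>0$ and let $d\mu(t)=\sinh^{2\lambda}t\,dt$ on $[0,\infty)$. Functions $f$ on $[1,\infty)$ are read through $t\mapsto f(\cosh t)$, $t\ge 0$; for $1\le p<\infty$, $L_{p,\lambda}[0,\infty)$ is the space of measurable $f$ with $$\|f\|_{L_{p,\lambda}}=\Big(\int_0^\infty |f(\cosh t)|^p\,d\mu(t)\Big)^{1/p}<\infty .$$ For $t,x\ge 0$ the generalized shift is $$A^{\lambda}_{\cosh t}f(\cosh x)=\frac{\Gamma(\lambda+\frac12)}{\Gamma(\frac12)\Gamma(\lambda)}\int_0^{\pi} f(\cosh x\cosh t-\sinh x\sinh t\cos\varphi)\,(\sin\varphi)^{2\lambda-1}\,d\varphi ,$$ and the modified Riesz–Gegenbauer fractional integral of $f$ is $$\widetilde{\mathfrak I}^{\alpha}_{G}f(\cosh x)=\int_0^\infty\Big(A^{\lambda}_{\cosh t}(\sinh x)^{\alpha-2\lambda-1}-(\sinh t)^{\alpha-2\lambda-1}\chi_{(1/4,\infty)}(t)\Big)f(\cosh t)\,d\mu(t),$$ where the shift acts on the function $\cosh x\mapsto(\sinh x)^{\alpha-2\lambda-1}$.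 With $H(0,r)=[0,r)$, the Gegenbauer space $BMO[0,\infty)$ consists of the $F$ locally integrable on $[0,\infty)$ with respect to $\mu$ with $$\|F\|_{BMO}=\sup_{x\ge 0,\ r>0}\frac1{\mu(H(0,r))}\int_{H(0,r)}\big|A^{\lambda}_{\cosh t}F(\cosh x)-F_{H(0,r)}(\cosh x)\big|\,d\mu(t)<\infty,$$ $$F_{H(0,r)}(\cosh x)=\frac1{\mu(H(0,r))}\int_{H(0,r)}A^{\lambda}_{\cosh t}F(\cosh x)\,d\mu(t).$$ **Theorem.** Let $0<\alpha<2\lambda+1$ and $p\alpha=2\lambda+1$. There is a constant $c_{\alpha,\lambda,p}>0$, depending only on $\alpha,\lambda,p$, such that for every (complex-valued) $f\in L_{p,\lambda}[0,\infty)$ the integral defining $\widetilde{\mathfrak I}^{\alpha}_{G}f(\cosh x)$ converges absolutely for almost every $x\ge 0$, $\widetilde{\mathfrak I}^{\alpha}_{G}f\in BMO[0,\infty)$, and $$\big\|\widetilde{\mathfrak I}^{\alpha}_{G}f\big\|_{BMO}\le c_{\alpha,\lambda,p}\,\|f\|_{L_{p,\lambda}} .$$ -/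

import Mathlib

open MeasureTheory Set

noncomputable section

/-- The measure `dμ(t) = sinh^{2λ} t dt` on the half-line `[0, ∞)`, as a measure on `ℝ`. -/
def gegenbauerMeasure (lam : ℝ) : Measure ℝ :=
  (volume.restrict (Ici (0 : ℝ))).withDensity
    (fun t => ENNReal.ofReal (Real.sinh t ^ (2 * lam)))

/-- The interval `H(x, r) = (x - r, x + r) ∩ [0, ∞)`. -/
def gegenbauerInterval (x r : ℝ) : Set ℝ :=
  Ioo (x - r) (x + r) ∩ Ici 0

/-- The generalized shift `A_u^λ f (v)`, for `u, v ≥ 1`, of a function `f` on `[1, ∞)`.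
With `u = cosh t`, `v = cosh x` and `t, x ≥ 0` it is the integral in
`gegenbauerShift_cosh` below. -/
def gegenbauerShift {E : Type*} [NormedAddCommGroup E] [NormedSpace ℝ E]
    (lam u : ℝ) (f : ℝ → E) (v : ℝ) : E :=
  (Real.Gamma (lam + 1 / 2) / (Real.Gamma (1 / 2) * Real.Gamma lam)) •
    ∫ φ in (0 : ℝ)..Real.pi,
      (Real.sin φ ^ (2 * lam - 1)) •
        f (v * u - √(v ^ 2 - 1) * √(u ^ 2 - 1) * Real.cos φ)

theorem sqrt_cosh_sq_sub_one {t : ℝ} (ht : 0 ≤ t) :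
    √(Real.cosh t ^ 2 - 1) = Real.sinh t := by
  rw [Real.cosh_sq, add_sub_cancel_right, Real.sqrt_sq (Real.sinh_nonneg_iff.2 ht)]

theorem gegenbauerShift_cosh {E : Type*} [NormedAddCommGroup E] [NormedSpace ℝ E]
    (lam : ℝ) (f : ℝ → E) {t x : ℝ} (ht : 0 ≤ t) (hx : 0 ≤ x) :
    gegenbauerShift lam (Real.cosh t) f (Real.cosh x) =
      (Real.Gamma (lam + 1 / 2) / (Real.Gamma (1 / 2) * Real.Gamma lam)) •
        ∫ φ in (0 : ℝ)..Real.pi,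
          (Real.sin φ ^ (2 * lam - 1)) •
            f (Real.cosh x * Real.cosh t - Real.sinh x * Real.sinh t * Real.cos φ) := by
  simp only [gegenbauerShift, sqrt_cosh_sq_sub_one ht, sqrt_cosh_sq_sub_one hx]

/-- The kernel `(sinh x)^{α - 2λ - 1}`, as a function of `y = cosh x ≥ 1`. -/
def rieszGegenbauerKernel (lam α y : ℝ) : ℝ :=
  √(y ^ 2 - 1) ^ (α - 2 * lam - 1)

/-- The integrand of the modified fractional integral at the point `y = cosh x`:
`(A_{cosh t}^λ (sinh x)^{α-2λ-1} - (sinh t)^{α-2λ-1} χ_{(1/4,∞)}(t)) f(cosh t)`. -/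
def modifiedRieszGegenbauerIntegrand (lam α : ℝ) (f : ℝ → ℂ) (y t : ℝ) : ℂ :=
  (gegenbauerShift lam (Real.cosh t) (rieszGegenbauerKernel lam α) y -
      (Ioi (1 / 4 : ℝ)).indicator (fun s => Real.sinh s ^ (α - 2 * lam - 1)) t) •
    f (Real.cosh t)

/-- The modified Riesz-Gegenbauer fractional integral of `f`, as a function of
`y = cosh x ≥ 1`. -/
def modifiedRieszGegenbauer (lam α : ℝ) (f : ℝ → ℂ) (y : ℝ) : ℂ :=
  ∫ t, modifiedRieszGegenbauerIntegrand lam α f y t ∂(gegenbauerMeasure lam)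

/-- The mean `f_{H(0,r)}(cosh x)` of `t ↦ A_{cosh t}^λ f (cosh x)` over `H(0, r)`. -/
def gegenbauerMean (lam : ℝ) (f : ℝ → ℂ) (x r : ℝ) : ℂ :=
  ⨍ t in gegenbauerInterval 0 r,
    gegenbauerShift lam (Real.cosh t) f (Real.cosh x) ∂(gegenbauerMeasure lam)

/-- The Gegenbauer BMO norm, with values in `[0, ∞]`. -/
def gegenbauerBMONorm (lam : ℝ) (f : ℝ → ℂ) : ENNReal :=
  ⨆ (x : ℝ) (_ : 0 ≤ x) (r : ℝ) (_ : 0 < r),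
    (gegenbauerMeasure lam (gegenbauerInterval 0 r))⁻¹ *
      ∫⁻ t in gegenbauerInterval 0 r,
        ‖gegenbauerShift lam (Real.cosh t) f (Real.cosh x) - gegenbauerMean lam f x r‖ₑ
          ∂(gegenbauerMeasure lam)

/-- Membership of `f` (a function on `[1, ∞)`, read through `t ↦ f (cosh t)`) in the
Gegenbauer BMO space: local integrability on `[0, ∞)` and finite BMO norm. -/
def MemGegenbauerBMO (lam : ℝ) (f : ℝ → ℂ) : Prop :=
  LocallyIntegrableOn (fun t => f (Real.cosh t)) (Ici 0) (gegenbauerMeasure lam) ∧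
    gegenbauerBMONorm lam f < ⊤

end

/-!
By the hyperbolic law of cosines the generalized shift averages a function over the distances from
a point to a circle, so it is a Markov operator preserving `μ`, and the associated convolution obeys
Young's inequality. Put `β = 2λ + 1 - α` and truncate the kernel `sinh ^ (-β)` at the scale
`R = min d 1`. The part removed has `L^1` norm of order `R ^ α`, hence at most of order
`μ(H(0, d)) ^ (1 / p)`, and Young's and Hölder's inequalities bound its mean over `H(0, d)`. For
`d ≤ 1` the part kept changes over distances at most `R` by no more than a multiple of
`R * cosh / max sinh (sinh R) ^ (β + 1)`, whose `L^q` norm is bounded independently of `R`; for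
`d ≥ 1` the kernel truncated at `1` is itself in `L^q`.
-/

namespace Gegenbauer

open Real
open scoped ENNReal

section General

variable {X Y E : Type*} [MeasurableSpace X] [MeasurableSpace Y] {μ : Measure X} {ν : Measure Y}

theorem lintegral_enorm_sub_average_le [NormedAddCommGroup E] [NormedSpace ℝ E] [CompleteSpace E]
    [IsFiniteMeasure μ] {f : X → E} (hf : AEStronglyMeasurable f μ) (c : E) :
    ∫⁻ x, ‖f x - ⨍ y, f y ∂μ‖ₑ ∂μ ≤ 2 * ∫⁻ x, ‖f x - c‖ₑ ∂μ := by
  rcases eq_or_ne μ 0 with rfl | hμ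
  · simp
  have : NeZero μ := ⟨hμ⟩
  rcases eq_or_ne (∫⁻ x, ‖f x - c‖ₑ ∂μ) ⊤ with htop | hfin
  · simp [htop]
  have hsub : Integrable (fun x => f x - c) μ :=
    ⟨hf.sub aestronglyMeasurable_const, lt_top_iff_ne_top.2 hfin⟩
  have hint : Integrable f μ :=
    (hsub.add (integrable_const c)).congr (.of_forall fun _ => sub_add_cancel _ _)
  have havg : c - ⨍ y, f y ∂μ = ⨍ y, (c - f y) ∂μ := by
    simp only [average, integral_sub (integrable_const c) hint.to_average, integral_const,
      probReal_univ, one_smul]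
  have hc : ‖c - ⨍ y, f y ∂μ‖ₑ * μ univ ≤ ∫⁻ x, ‖f x - c‖ₑ ∂μ := by
    rw [havg, ← measure_mul_laverage, mul_comm]
    simp only [enorm_sub_rev (f _) c]
    gcongr
    exact enorm_integral_le_lintegral_enorm _
  calc ∫⁻ x, ‖f x - ⨍ y, f y ∂μ‖ₑ ∂μ
      ≤ ∫⁻ x, (‖f x - c‖ₑ + ‖c - ⨍ y, f y ∂μ‖ₑ) ∂μ :=
        lintegral_mono fun x => by simpa using enorm_add_le (f x - c) (c - ⨍ y, f y ∂μ)
    _ = ∫⁻ x, ‖f x - c‖ₑ ∂μ + ‖c - ⨍ y, f y ∂μ‖ₑ * μ univ := by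
        rw [lintegral_add_right _ measurable_const, lintegral_const]
    _ ≤ 2 * ∫⁻ x, ‖f x - c‖ₑ ∂μ := by rw [two_mul]; gcongr

theorem lintegral_mul_rpow_le {p q : ℝ} (hpq : p.HolderConjugate q) {k h : X → ℝ≥0∞}
    (hk : AEMeasurable k μ) (hh : AEMeasurable h μ) :
    (∫⁻ x, k x * h x ∂μ) ^ p ≤ (∫⁻ x, k x ∂μ) ^ (p - 1) * ∫⁻ x, k x * h x ^ p ∂μ := by
  have hsplit (x : X) : k x * h x = k x ^ (1 / q) * (k x ^ (1 / p) * h x) := by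
    rw [← mul_assoc, ← ENNReal.rpow_add_of_nonneg _ _ hpq.symm.one_div_nonneg hpq.one_div_nonneg,
      add_comm, one_div, one_div, hpq.inv_add_inv_eq_one, ENNReal.rpow_one]
  calc (∫⁻ x, k x * h x ∂μ) ^ p
      = (∫⁻ x, k x ^ (1 / q) * (k x ^ (1 / p) * h x) ∂μ) ^ p := by simp only [← hsplit]
    _ ≤ ((∫⁻ x, (k x ^ (1 / q)) ^ q ∂μ) ^ (1 / q) *
          (∫⁻ x, (k x ^ (1 / p) * h x) ^ p ∂μ) ^ (1 / p)) ^ p :=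
        ENNReal.rpow_le_rpow (ENNReal.lintegral_mul_le_Lp_mul_Lq μ hpq.symm (hk.pow_const _)
          ((hk.pow_const _).mul hh)) hpq.nonneg
    _ = (∫⁻ x, k x ∂μ) ^ (p - 1) * ∫⁻ x, k x * h x ^ p ∂μ := by
        simp only [ENNReal.mul_rpow_of_nonneg _ _ hpq.nonneg, ← ENNReal.rpow_mul,
          one_div_mul_cancel hpq.ne_zero, one_div_mul_cancel hpq.symm.ne_zero, ENNReal.rpow_one,
          one_div_mul_eq_div, hpq.div_conj_eq_sub_one]

theorem eLpNorm'_lintegral_mul_le {p q : ℝ} (hpq : p.HolderConjugate q) [SFinite μ] [SFinite ν]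
    {K : X → Y → ℝ≥0∞} (hK : Measurable (Function.uncurry K)) {h : Y → ℝ≥0∞} (hh : Measurable h)
    {A : ℝ≥0∞} (hrow : ∀ᵐ x ∂μ, ∫⁻ y, K x y ∂ν ≤ A) (hcol : ∀ᵐ y ∂ν, ∫⁻ x, K x y ∂μ ≤ A) :
    eLpNorm' (fun x => ∫⁻ y, K x y * h y ∂ν) p μ ≤ A * eLpNorm' h p ν := by
  have hp := hpq.sub_one_pos
  have hpow : ∫⁻ x, (∫⁻ y, K x y * h y ∂ν) ^ p ∂μ ≤ A ^ p * ∫⁻ y, h y ^ p ∂ν :=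
    calc ∫⁻ x, (∫⁻ y, K x y * h y ∂ν) ^ p ∂μ
        ≤ ∫⁻ x, A ^ (p - 1) * ∫⁻ y, K x y * h y ^ p ∂ν ∂μ := by
          refine lintegral_mono_ae (hrow.mono fun x hx => ?_)
          refine (lintegral_mul_rpow_le hpq (by fun_prop) hh.aemeasurable).trans ?_
          gcongr
      _ = A ^ (p - 1) * ∫⁻ y, (∫⁻ x, K x y ∂μ) * h y ^ p ∂ν := by
          rw [lintegral_const_mul _ (by fun_prop), lintegral_lintegral_swap (by fun_prop)]
          simp only [lintegral_mul_const _ (hK.of_uncurry_right)]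
      _ ≤ A ^ (p - 1) * ∫⁻ y, A * h y ^ p ∂ν := by
          refine mul_le_mul_right (lintegral_mono_ae (hcol.mono fun y hy => ?_)) _
          gcongr
      _ = A ^ p * ∫⁻ y, h y ^ p ∂ν := by
          rw [lintegral_const_mul _ (by fun_prop), ← mul_assoc]
          nth_rw 2 [← ENNReal.rpow_one A]
          rw [← ENNReal.rpow_add_of_nonneg _ _ hp.le zero_le_one, sub_add_cancel]
  calc eLpNorm' (fun x => ∫⁻ y, K x y * h y ∂ν) p μ
      ≤ (A ^ p * ∫⁻ y, h y ^ p ∂ν) ^ (1 / p) := by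
        simpa only [eLpNorm', enorm_eq_self] using ENNReal.rpow_le_rpow hpow hpq.one_div_nonneg
    _ = A * eLpNorm' h p ν := by
        simp only [eLpNorm', enorm_eq_self]
        rw [ENNReal.mul_rpow_of_nonneg _ _ hpq.one_div_nonneg, ← ENNReal.rpow_mul,
          mul_one_div_cancel hpq.ne_zero, ENNReal.rpow_one]

end General

/-- The constant `Γ(λ + 1/2) / (Γ(1/2) Γ(λ))` that normalises the generalized shift. -/
noncomputable def shiftConst (lam : ℝ) : ℝ :=
  Gamma (lam + 1 / 2) / (Gamma (1 / 2) * Gamma lam)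

/-- The probability measure on `(0, π)` over which the generalized shift averages. -/
noncomputable def angleMeasure (lam : ℝ) : Measure ℝ :=
  (volume.restrict (Ioo 0 π)).withDensity
    fun φ => ENNReal.ofReal (shiftConst lam * sin φ ^ (2 * lam - 1))

theorem shiftConst_pos {lam : ℝ} (hlam : 0 < lam) : 0 < shiftConst lam :=
  div_pos (Gamma_pos_of_pos (by positivity))
    (mul_pos (Gamma_pos_of_pos (by positivity)) (Gamma_pos_of_pos hlam))

theorem shiftConst_mul_beta {lam : ℝ} (hlam : 0 < lam) :
    shiftConst lam * ProbabilityTheory.beta lam lam = 2 ^ (1 - 2 * lam) := by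
  have := Gamma_pos_of_pos hlam
  have := Gamma_pos_of_pos (by positivity : 0 < 2 * lam)
  have hdup := Gamma_mul_Gamma_add_half lam
  rw [shiftConst, ProbabilityTheory.beta, Gamma_one_half_eq, ← two_mul]
  rw [div_mul_div_comm, div_eq_iff (by positivity)]
  linear_combination (Gamma lam) * hdup

theorem shiftConst_mul_sin_rpow_eq {lam φ : ℝ} (hlam : 0 < lam) (hφ : φ ∈ Ioo 0 π) :
    shiftConst lam * sin φ ^ (2 * lam - 1) =
      |sin φ / 2| * (1 / ProbabilityTheory.beta lam lam * ((1 - cos φ) / 2) ^ (lam - 1) *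
        (1 - (1 - cos φ) / 2) ^ (lam - 1)) := by
  have hbeta := ProbabilityTheory.beta_pos hlam hlam
  have hsin := sin_pos_of_mem_Ioo hφ
  have hprod : (1 - cos φ) / 2 * (1 - (1 - cos φ) / 2) = (sin φ / 2) ^ (2 : ℝ) := by
    rw [rpow_two, div_pow, sin_sq]
    ring
  rw [mul_assoc (1 / _), ← mul_rpow (by linarith [cos_le_one φ]) (by linarith [neg_one_le_cos φ]),
    hprod, ← rpow_mul (by positivity), abs_of_pos (by positivity),
    eq_div_of_mul_eq hbeta.ne' (shiftConst_mul_beta hlam),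
    show 2 * lam - 1 = 2 * (lam - 1) + 1 by ring, rpow_add hsin, rpow_one,
    div_rpow hsin.le two_pos.le, show 1 - 2 * lam = -1 - 2 * (lam - 1) by ring,
    rpow_sub two_pos, rpow_neg_one]
  ring

theorem image_one_sub_cos_div_two : (fun φ => (1 - cos φ) / 2) '' Ioo 0 π = Ioo 0 1 := by
  ext u
  constructor
  · rintro ⟨φ, hφ, rfl⟩
    have hcos : cos φ ∈ Ioo (-1) 1 := cosPartialHomeomorph.map_source hφ
    exact ⟨by linarith [hcos.2], by linarith [hcos.1]⟩
  · rintro ⟨h0, h1⟩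
    refine ⟨arccos (1 - 2 * u), ⟨arccos_pos.2 (by linarith), arccos_lt_pi.2 (by linarith)⟩, ?_⟩
    simp only [cos_arccos (by linarith : -1 ≤ 1 - 2 * u) (by linarith)]
    ring

theorem isProbabilityMeasure_angleMeasure {lam : ℝ} (hlam : 0 < lam) :
    IsProbabilityMeasure (angleMeasure lam) where
  measure_univ := by
    have hinj : InjOn (fun φ => (1 - cos φ) / 2) (Ioo 0 π) := fun a ha b hb hab =>
      injOn_cos (Ioo_subset_Icc_self ha) (Ioo_subset_Icc_self hb) (by simp only at hab; linarith)
    have hderiv (φ : ℝ) : HasDerivAt (fun φ => (1 - cos φ) / 2) (sin φ / 2) φ := by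
      simpa using ((hasDerivAt_cos φ).const_sub 1).div_const 2
    rw [angleMeasure, withDensity_apply _ MeasurableSet.univ, Measure.restrict_univ,
      ← ProbabilityTheory.lintegral_betaPDF_eq_one hlam hlam, ProbabilityTheory.lintegral_betaPDF,
      ← image_one_sub_cos_div_two, lintegral_image_eq_lintegral_abs_deriv_mul measurableSet_Ioo
        (fun φ _ => (hderiv φ).hasDerivWithinAt) hinj]
    refine setLIntegral_congr_fun measurableSet_Ioo fun φ hφ => ?_
    rw [← ENNReal.ofReal_mul (abs_nonneg _), shiftConst_mul_sin_rpow_eq hlam hφ]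

instance (lam : ℝ) : SFinite (angleMeasure lam) := by
  unfold angleMeasure; infer_instance

instance (lam : ℝ) : SFinite (gegenbauerMeasure lam) := by
  unfold gegenbauerMeasure; infer_instance

theorem lintegral_angleMeasure (lam : ℝ) (k : ℝ → ℝ≥0∞) :
    ∫⁻ φ, k φ ∂(angleMeasure lam) =
      ∫⁻ φ in Ioo 0 π, ENNReal.ofReal (shiftConst lam * sin φ ^ (2 * lam - 1)) * k φ :=
  lintegral_withDensity_eq_lintegral_mul_non_measurable _ (by fun_prop) (by simp) _

theorem lintegral_gegenbauerMeasure (lam : ℝ) (k : ℝ → ℝ≥0∞) :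
    ∫⁻ t, k t ∂(gegenbauerMeasure lam) =
      ∫⁻ t in Ioi 0, ENNReal.ofReal (sinh t ^ (2 * lam)) * k t := by
  rw [restrict_Ioi_eq_restrict_Ici]
  exact lintegral_withDensity_eq_lintegral_mul_non_measurable _ (by fun_prop) (by simp) _

theorem gegenbauerMeasure_absolutelyContinuous (lam : ℝ) :
    gegenbauerMeasure lam ≪ volume.restrict (Ioi 0) := by
  rw [restrict_Ioi_eq_restrict_Ici]
  exact withDensity_absolutelyContinuous _ _

theorem ae_gegenbauerMeasure_pos (lam : ℝ) : ∀ᵐ t ∂(gegenbauerMeasure lam), 0 < t :=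
  (gegenbauerMeasure_absolutelyContinuous lam).ae_le (ae_restrict_mem measurableSet_Ioi)

theorem ae_gegenbauerMeasure_ne (lam a : ℝ) : ∀ᵐ t ∂(gegenbauerMeasure lam), t ≠ a :=
  (gegenbauerMeasure_absolutelyContinuous lam).ae_le (ae_restrict_of_ae (Measure.ae_ne volume a))

theorem lintegral_image_sinh {s : Set ℝ} (hs : MeasurableSet s) (G : ℝ → ℝ≥0∞) :
    ∫⁻ u in sinh '' s, G u = ∫⁻ t in s, ENNReal.ofReal (cosh t) * G (sinh t) := by
  rw [lintegral_image_eq_lintegral_abs_deriv_mul hs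
    (fun x _ => (hasDerivAt_sinh x).hasDerivWithinAt) sinh_injective.injOn]
  simp only [abs_of_pos (cosh_pos _)]

/-- The argument `v u - √(v² - 1) √(u² - 1) cos φ` at which the generalized shift evaluates its
function; by the hyperbolic law of cosines, the hyperbolic cosine of the third side of a triangle
with sides `arcosh v`, `arcosh u` and angle `φ`. -/
noncomputable def shiftPoint (v u φ : ℝ) : ℝ :=
  v * u - √(v ^ 2 - 1) * √(u ^ 2 - 1) * cos φ

theorem shiftPoint_comm (v u φ : ℝ) : shiftPoint v u φ = shiftPoint u v φ := by
  unfold shiftPoint; ring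

theorem shiftPoint_cosh {x t : ℝ} (hx : 0 ≤ x) (ht : 0 ≤ t) (φ : ℝ) :
    shiftPoint (cosh x) (cosh t) φ = cosh x * cosh t - sinh x * sinh t * cos φ := by
  simp only [shiftPoint, sqrt_cosh_sq_sub_one ht, sqrt_cosh_sq_sub_one hx]

theorem shiftPoint_one_left (u φ : ℝ) : shiftPoint 1 u φ = u := by
  simp [shiftPoint]

@[fun_prop]
theorem measurable_shiftPoint {X : Type*} [MeasurableSpace X] {v u φ : X → ℝ} (hv : Measurable v)
    (hu : Measurable u) (hφ : Measurable φ) :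
    Measurable fun a => shiftPoint (v a) (u a) (φ a) := by
  unfold shiftPoint; fun_prop

theorem gegenbauerShift_eq_integral {E : Type*} [NormedAddCommGroup E] [NormedSpace ℝ E] {lam : ℝ}
    (hlam : 0 < lam) (u : ℝ) (f : ℝ → E) (v : ℝ) :
    gegenbauerShift lam u f v = ∫ φ, f (shiftPoint v u φ) ∂(angleMeasure lam) := by
  rw [gegenbauerShift, intervalIntegral.integral_of_le pi_pos.le, ← integral_smul,
    integral_Ioc_eq_integral_Ioo, angleMeasure,
    integral_withDensity_eq_integral_toReal_smul (by fun_prop) (by simp)]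
  refine setIntegral_congr_fun measurableSet_Ioo fun φ hφ => ?_
  have hsin := rpow_nonneg (sin_pos_of_mem_Ioo hφ).le (2 * lam - 1)
  rw [ENNReal.toReal_ofReal (mul_nonneg (shiftConst_pos hlam).le hsin), smul_smul]
  rfl

theorem lintegral_upperHalfPlane_polar {G : ℝ × ℝ → ℝ≥0∞} (hG : Measurable G) :
    ∫⁻ z in univ ×ˢ Ioi (0 : ℝ), G z =
      ∫⁻ r in Ioi 0, ∫⁻ φ in Ioo 0 π, ENNReal.ofReal r * G (r * cos φ, r * sin φ) := by
  have hS : MeasurableSet (univ ×ˢ Ioi (0 : ℝ) : Set (ℝ × ℝ)) :=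
    MeasurableSet.univ.prod measurableSet_Ioi
  have hT : MeasurableSet (Ioi (0 : ℝ) ×ˢ Ioo 0 π) := measurableSet_Ioi.prod measurableSet_Ioo
  have hsub : Ioi (0 : ℝ) ×ˢ Ioo 0 π ⊆ polarCoord.target :=
    prod_mono_right (Ioo_subset_Ioo_left (neg_nonpos.2 pi_pos.le))
  have hsin {p : ℝ × ℝ} (hp : p ∈ polarCoord.target) :
      p ∈ Ioi (0 : ℝ) ×ˢ Ioo 0 π ↔ 0 < p.1 * sin p.2 := by
    rw [mul_pos_iff_of_pos_left hp.1]
    refine ⟨fun h => sin_pos_of_mem_Ioo h.2, fun h => ⟨hp.1, ?_, hp.2.2⟩⟩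
    by_contra! hneg
    exact h.not_ge (sin_nonpos_of_nonpos_of_neg_pi_le hneg hp.2.1.le)
  calc ∫⁻ z in univ ×ˢ Ioi (0 : ℝ), G z
      = ∫⁻ p in polarCoord.target, ENNReal.ofReal p.1 •
          (univ ×ˢ Ioi (0 : ℝ)).indicator G (polarCoord.symm p) := by
        rw [lintegral_comp_polarCoord_symm, lintegral_indicator hS]
    _ = ∫⁻ p in polarCoord.target, (Ioi (0 : ℝ) ×ˢ Ioo 0 π).indicator
          (fun p => ENNReal.ofReal p.1 * G (p.1 * cos p.2, p.1 * sin p.2)) p := by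
        refine setLIntegral_congr_fun polarCoord.open_target.measurableSet fun p hp => ?_
        simp only [indicator, polarCoord_symm_apply, mem_prod, mem_univ, true_and, mem_Ioi,
          hsin hp, smul_eq_mul, mul_ite, mul_zero]
    _ = ∫⁻ r in Ioi 0, ∫⁻ φ in Ioo 0 π, ENNReal.ofReal r * G (r * cos φ, r * sin φ) := by
        rw [setLIntegral_indicator hT, inter_eq_left.2 hsub, Measure.volume_eq_prod,
          ← Measure.prod_restrict, lintegral_prod _ (by fun_prop)]

-- The substitution `w = √(1 + y²) sinh τ` turns `√(1 + y² + w²) cosh x - w sinh x` into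
-- `√(1 + y²) cosh (τ - x)`.
theorem lintegral_horizontal (k : ℝ → ℝ≥0∞) (x y : ℝ) :
    ∫⁻ w, ENNReal.ofReal (√(1 + y ^ 2 + w ^ 2))⁻¹ *
        k (√(1 + y ^ 2 + w ^ 2) * cosh x - w * sinh x) =
      ∫⁻ τ, k (√(1 + y ^ 2) * cosh τ) := by
  set b := √(1 + y ^ 2)
  have hb₀ : 0 < b := sqrt_pos.2 (by positivity)
  have hb₂ : b ^ 2 = 1 + y ^ 2 := sq_sqrt (by positivity)
  have hsqrt (τ : ℝ) : √(1 + y ^ 2 + (b * sinh τ) ^ 2) = b * cosh τ := by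
    rw [← hb₂, ← sqrt_sq (by positivity : 0 ≤ b * cosh τ), mul_pow b (cosh τ), cosh_sq]
    ring_nf
  have himage : (fun τ => b * sinh τ) '' univ = univ :=
    image_univ_of_surjective ((mul_left_surjective₀ hb₀.ne').comp sinh_surjective)
  have hinj : InjOn (fun τ => b * sinh τ) univ :=
    ((mul_right_injective₀ hb₀.ne').comp sinh_injective).injOn
  rw [← setLIntegral_univ, ← himage, lintegral_image_eq_lintegral_abs_deriv_mul .univ
    (fun τ _ => ((hasDerivAt_sinh τ).const_mul b).hasDerivWithinAt) hinj, setLIntegral_univ,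
    ← lintegral_sub_right_eq_self (fun τ => k (b * cosh τ)) x]
  refine lintegral_congr fun τ => ?_
  have hpos : 0 < b * cosh τ := by positivity
  rw [hsqrt, abs_of_pos hpos, ← mul_assoc, ← ENNReal.ofReal_mul hpos.le,
    mul_inv_cancel₀ hpos.ne', ENNReal.ofReal_one, one_mul, cosh_sub]
  ring_nf

/-- The generalized shift of a nonnegative function, as a Lebesgue integral. -/
noncomputable def lshift (lam u : ℝ) (k : ℝ → ℝ≥0∞) (v : ℝ) : ℝ≥0∞ :=
  ∫⁻ φ, k (shiftPoint v u φ) ∂(angleMeasure lam)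

theorem lshift_comm (lam u v : ℝ) (k : ℝ → ℝ≥0∞) : lshift lam u k v = lshift lam v k u := by
  simp only [lshift, shiftPoint_comm v u]

theorem lshift_const_mul (lam u v : ℝ) (c : ℝ≥0∞) {k : ℝ → ℝ≥0∞} (hk : Measurable k) :
    lshift lam u (fun y => c * k y) v = c * lshift lam u k v :=
  lintegral_const_mul _ (by fun_prop)

theorem lshift_one_right {lam : ℝ} (hlam : 0 < lam) (u : ℝ) (k : ℝ → ℝ≥0∞) :
    lshift lam u k 1 = k u := by
  have := isProbabilityMeasure_angleMeasure hlam
  simp [lshift, shiftPoint_one_left]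

@[fun_prop]
theorem measurable_lshift {X : Type*} [MeasurableSpace X] {lam : ℝ} {k : ℝ → ℝ≥0∞}
    (hk : Measurable k) {u v : X → ℝ} (hu : Measurable u) (hv : Measurable v) :
    Measurable fun a => lshift lam (u a) k (v a) :=
  Measurable.lintegral_prod_right'
    (by fun_prop : Measurable fun z : X × ℝ => k (shiftPoint (v z.1) (u z.1) z.2))

/-- The density, on the upper half-plane with coordinates `(sinh t cos φ, sinh t sin φ)`, against
which the iterated integral of a generalized shift becomes a planar Lebesgue integral. -/
noncomputable def halfPlaneDensity (lam : ℝ) (k : ℝ → ℝ≥0∞) (x : ℝ) (z : ℝ × ℝ) : ℝ≥0∞ :=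
  ENNReal.ofReal (shiftConst lam * z.2 ^ (2 * lam - 1)) *
    (ENNReal.ofReal (√(1 + z.2 ^ 2 + z.1 ^ 2))⁻¹ *
      k (√(1 + z.2 ^ 2 + z.1 ^ 2) * cosh x - z.1 * sinh x))

theorem measurable_halfPlaneDensity (lam : ℝ) {k : ℝ → ℝ≥0∞} (hk : Measurable k) (x : ℝ) :
    Measurable (halfPlaneDensity lam k x) := by
  unfold halfPlaneDensity; fun_prop

theorem halfPlaneDensity_polar (lam : ℝ) (k : ℝ → ℝ≥0∞) {x t φ : ℝ} (hx : 0 ≤ x) (ht : 0 < t)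
    (hφ : φ ∈ Ioo 0 π) :
    ENNReal.ofReal (cosh t) *
        (ENNReal.ofReal (sinh t) * halfPlaneDensity lam k x (sinh t * cos φ, sinh t * sin φ)) =
      ENNReal.ofReal (sinh t ^ (2 * lam)) *
        (ENNReal.ofReal (shiftConst lam * sin φ ^ (2 * lam - 1)) *
          k (shiftPoint (cosh x) (cosh t) φ)) := by
  have hsinh := sinh_pos_iff.2 ht
  have hsin := sin_pos_of_mem_Ioo hφ
  have hcosh := cosh_pos t
  have hsqrt : √(1 + (sinh t * sin φ) ^ 2 + (sinh t * cos φ) ^ 2) = cosh t := by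
    rw [← sqrt_sq hcosh.le, cosh_sq, mul_pow, mul_pow, cos_sq']
    ring_nf
  have hpoint : cosh t * cosh x - sinh t * cos φ * sinh x =
      cosh x * cosh t - sinh x * sinh t * cos φ := by ring
  simp only [halfPlaneDensity, hsqrt, shiftPoint_cosh hx ht.le, hpoint, ← mul_assoc]
  congr 1
  rw [← ENNReal.ofReal_mul (by positivity), ← ENNReal.ofReal_mul (by positivity),
    ← ENNReal.ofReal_mul' (by positivity), ← ENNReal.ofReal_mul (by positivity),
    mul_rpow hsinh.le hsin.le, rpow_sub_one hsinh.ne']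
  congr 1
  field_simp

theorem lintegral_lshift_eq_halfPlane (lam : ℝ) {k : ℝ → ℝ≥0∞} (hk : Measurable k) {x : ℝ}
    (hx : 0 ≤ x) :
    ∫⁻ t, lshift lam (cosh t) k (cosh x) ∂(gegenbauerMeasure lam) =
      ∫⁻ z in univ ×ˢ Ioi (0 : ℝ), halfPlaneDensity lam k x z := by
  have hsinh : sinh '' Ioi 0 = Ioi 0 := (sinhOrderIso.image_Ioi 0).trans (by simp)
  have hG := measurable_halfPlaneDensity lam hk x
  rw [lintegral_upperHalfPlane_polar hG, ← hsinh, lintegral_image_sinh measurableSet_Ioi]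
  simp only [lintegral_gegenbauerMeasure, lshift, lintegral_angleMeasure]
  refine setLIntegral_congr_fun measurableSet_Ioi fun t ht => ?_
  rw [← lintegral_const_mul _ (by fun_prop), ← lintegral_const_mul _ (by fun_prop)]
  exact setLIntegral_congr_fun measurableSet_Ioo fun φ hφ =>
    (halfPlaneDensity_polar lam k hx ht hφ).symm

theorem lintegral_lshift_eq_lintegral_cosh (lam : ℝ) {k : ℝ → ℝ≥0∞} (hk : Measurable k) {x : ℝ}
    (hx : 0 ≤ x) :
    ∫⁻ t, lshift lam (cosh t) k (cosh x) ∂(gegenbauerMeasure lam) =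
      ∫⁻ y in Ioi 0, ENNReal.ofReal (shiftConst lam * y ^ (2 * lam - 1)) *
        ∫⁻ τ, k (√(1 + y ^ 2) * cosh τ) := by
  rw [lintegral_lshift_eq_halfPlane lam hk hx, Measure.volume_eq_prod, setLIntegral_prod_symm _
    (measurable_halfPlaneDensity lam hk x).aemeasurable, Measure.restrict_univ]
  refine lintegral_congr fun y => ?_
  simp only [halfPlaneDensity]
  rw [lintegral_const_mul _ (by fun_prop), lintegral_horizontal]

theorem lintegral_lshift {lam : ℝ} (hlam : 0 < lam) {k : ℝ → ℝ≥0∞} (hk : Measurable k) {x : ℝ}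
    (hx : 0 ≤ x) :
    ∫⁻ t, lshift lam (cosh t) k (cosh x) ∂(gegenbauerMeasure lam) =
      ∫⁻ t, k (cosh t) ∂(gegenbauerMeasure lam) := by
  rw [lintegral_lshift_eq_lintegral_cosh lam hk hx,
    ← lintegral_lshift_eq_lintegral_cosh lam hk le_rfl]
  simp only [cosh_zero, lshift_one_right hlam]

section Convolution

variable {lam p q x : ℝ} {k : ℝ → ℝ≥0∞}

theorem lshift_rpow_le (hlam : 0 < lam) (hpq : p.HolderConjugate q) (hk : Measurable k) (u v : ℝ) :
    lshift lam u k v ^ p ≤ lshift lam u (fun y => k y ^ p) v := by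
  have := isProbabilityMeasure_angleMeasure hlam
  simpa [lshift] using lintegral_mul_rpow_le hpq (μ := angleMeasure lam) (k := 1)
    aemeasurable_one (h := fun φ => k (shiftPoint v u φ)) (by fun_prop)

theorem eLpNorm'_lshift_le (hlam : 0 < lam) (hpq : p.HolderConjugate q) (hk : Measurable k)
    (hx : 0 ≤ x) :
    eLpNorm' (fun t => lshift lam (cosh t) k (cosh x)) p (gegenbauerMeasure lam) ≤
      eLpNorm' (fun t => k (cosh t)) p (gegenbauerMeasure lam) := by
  simp only [eLpNorm', enorm_eq_self]
  refine ENNReal.rpow_le_rpow ?_ hpq.one_div_nonneg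
  exact (lintegral_mono fun t => lshift_rpow_le hlam hpq hk _ _).trans_eq
    (lintegral_lshift hlam (hk.pow_const p) hx)

theorem setLIntegral_lshift_le (hlam : 0 < lam) (hpq : p.HolderConjugate q) (hk : Measurable k)
    (hx : 0 ≤ x) (s : Set ℝ) :
    ∫⁻ t in s, lshift lam (cosh t) k (cosh x) ∂(gegenbauerMeasure lam) ≤
      eLpNorm' (fun t => k (cosh t)) p (gegenbauerMeasure lam) *
        gegenbauerMeasure lam s ^ (1 / q) :=
  calc ∫⁻ t in s, lshift lam (cosh t) k (cosh x) ∂(gegenbauerMeasure lam)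
      ≤ eLpNorm' (fun t => lshift lam (cosh t) k (cosh x)) p
          ((gegenbauerMeasure lam).restrict s) * gegenbauerMeasure lam s ^ (1 / q) := by
        simpa [eLpNorm'] using ENNReal.lintegral_mul_le_Lp_mul_Lq
          ((gegenbauerMeasure lam).restrict s) hpq
          (f := fun t => lshift lam (cosh t) k (cosh x)) (g := 1) (by fun_prop) aemeasurable_one
    _ ≤ eLpNorm' (fun t => k (cosh t)) p (gegenbauerMeasure lam) *
          gegenbauerMeasure lam s ^ (1 / q) := by
        gcongr
        exact (eLpNorm'_mono_measure _ Measure.restrict_le_self hpq.nonneg).trans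
          (eLpNorm'_lshift_le hlam hpq hk hx)

/-- The convolution on the Gegenbauer hypergroup, `∫ A_{cosh s} k (v) h(s) dμ(s)`, of nonnegative
functions `k` on `[1, ∞)` and `h` on `[0, ∞)`. -/
noncomputable def shiftConv (lam : ℝ) (k h : ℝ → ℝ≥0∞) (v : ℝ) : ℝ≥0∞ :=
  ∫⁻ s, lshift lam (cosh s) k v * h s ∂(gegenbauerMeasure lam)

variable {h : ℝ → ℝ≥0∞}

theorem measurable_shiftConv (hk : Measurable k) (hh : Measurable h) :
    Measurable (shiftConv lam k h) :=
  Measurable.lintegral_prod_right'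
    (by fun_prop : Measurable fun z : ℝ × ℝ => lshift lam (cosh z.2) k z.1 * h z.2)

theorem shiftConv_cosh_le (hlam : 0 < lam) (hpq : p.HolderConjugate q) (hk : Measurable k)
    (hh : Measurable h) (hx : 0 ≤ x) :
    shiftConv lam k h (cosh x) ≤
      eLpNorm' (fun t => k (cosh t)) q (gegenbauerMeasure lam) *
        eLpNorm' h p (gegenbauerMeasure lam) := by
  have hHolder : shiftConv lam k h (cosh x) ≤
      eLpNorm' (fun s => lshift lam (cosh s) k (cosh x)) q (gegenbauerMeasure lam) *
        eLpNorm' h p (gegenbauerMeasure lam) :=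
    ENNReal.lintegral_mul_le_Lp_mul_Lq _ hpq.symm (by fun_prop) hh.aemeasurable
  refine hHolder.trans ?_
  gcongr
  exact eLpNorm'_lshift_le hlam hpq.symm hk hx

theorem eLpNorm'_shiftConv_le (hlam : 0 < lam) (hpq : p.HolderConjugate q) (hk : Measurable k)
    (hh : Measurable h) :
    eLpNorm' (fun t => shiftConv lam k h (cosh t)) p (gegenbauerMeasure lam) ≤
      (∫⁻ t, k (cosh t) ∂(gegenbauerMeasure lam)) * eLpNorm' h p (gegenbauerMeasure lam) := by
  refine eLpNorm'_lintegral_mul_le hpq (by fun_prop) hh ?_ ?_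
  · filter_upwards [ae_gegenbauerMeasure_pos lam] with x hx
    exact (lintegral_lshift hlam hk hx.le).le
  · filter_upwards [ae_gegenbauerMeasure_pos lam] with s hs
    simp only [lshift_comm lam (cosh s)]
    exact (lintegral_lshift hlam hk hs.le).le

end Convolution

section HyperbolicDistance

variable {r x s : ℝ}

/-- The third side of the hyperbolic triangle with sides `x` and `s` enclosing the angle `φ`. The
law of cosines identifies its hyperbolic cosine with `shiftPoint (cosh x) (cosh s) φ`. -/
noncomputable def shiftDist (x s φ : ℝ) : ℝ :=
  arcosh (shiftPoint (cosh x) (cosh s) φ)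

theorem cosh_sub_le_shiftPoint (hx : 0 ≤ x) (hs : 0 ≤ s) (φ : ℝ) :
    cosh (x - s) ≤ shiftPoint (cosh x) (cosh s) φ := by
  rw [shiftPoint_cosh hx hs, cosh_sub]
  have hsinh : 0 ≤ sinh x * sinh s := mul_nonneg (sinh_nonneg_iff.2 hx) (sinh_nonneg_iff.2 hs)
  linarith [mul_le_of_le_one_right hsinh (cos_le_one φ)]

theorem one_le_shiftPoint (hx : 0 ≤ x) (hs : 0 ≤ s) (φ : ℝ) :
    1 ≤ shiftPoint (cosh x) (cosh s) φ :=
  (one_le_cosh _).trans (cosh_sub_le_shiftPoint hx hs φ)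

theorem cosh_shiftDist (hx : 0 ≤ x) (hs : 0 ≤ s) (φ : ℝ) :
    cosh (shiftDist x s φ) = shiftPoint (cosh x) (cosh s) φ :=
  cosh_arcosh (one_le_shiftPoint hx hs φ)

theorem shiftDist_nonneg (hx : 0 ≤ x) (hs : 0 ≤ s) (φ : ℝ) : 0 ≤ shiftDist x s φ :=
  arcosh_nonneg (one_le_shiftPoint hx hs φ)

theorem shiftDist_comm (x s φ : ℝ) : shiftDist x s φ = shiftDist s x φ := by
  rw [shiftDist, shiftPoint_comm, shiftDist]

theorem shiftDist_zero_left (hs : 0 ≤ s) (φ : ℝ) : shiftDist 0 s φ = s := by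
  rw [shiftDist, cosh_zero, shiftPoint_one_left, arcosh_cosh hs]

theorem abs_sub_le_shiftDist (hx : 0 ≤ x) (hs : 0 ≤ s) (φ : ℝ) : |x - s| ≤ shiftDist x s φ := by
  have hcosh := cosh_sub_le_shiftPoint hx hs φ
  rwa [← cosh_shiftDist hx hs, cosh_le_cosh, abs_of_nonneg (shiftDist_nonneg hx hs φ)] at hcosh

theorem shiftDist_le_add_abs_sub (hr : 0 ≤ r) (hx : 0 ≤ x) (hs : 0 ≤ s) (φ : ℝ) :
    shiftDist r s φ ≤ shiftDist x s φ + |r - x| := by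
  set τ := shiftDist x s φ
  have hτ : 0 ≤ τ := shiftDist_nonneg hx hs φ
  -- Up to sign, `w` is `sinh τ` times the cosine of the angle between the sides `τ` and `x`.
  set w := sinh x * cosh s - cosh x * sinh s * cos φ with hw
  have hcosh : cosh (shiftDist r s φ) = cosh τ * cosh (r - x) + w * sinh (r - x) := by
    obtain ⟨δ, rfl⟩ : ∃ δ, r = x + δ := ⟨r - x, by ring⟩
    rw [cosh_shiftDist hr hs, cosh_shiftDist hx hs, shiftPoint_cosh hr hs, shiftPoint_cosh hx hs,
      cosh_add, sinh_add, hw, add_sub_cancel_left]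
    ring
  have hw_le : |w| ≤ sinh τ := by
    refine abs_le_of_sq_le_sq ?_ (sinh_nonneg_iff.2 hτ)
    have hsq : sinh τ ^ 2 = w ^ 2 + (sinh s * sin φ) ^ 2 := by
      rw [sinh_sq, cosh_shiftDist hx hs, shiftPoint_cosh hx hs, hw, mul_pow _ (sin φ), sin_sq]
      linear_combination (cosh s ^ 2 - sinh s ^ 2 * cos φ ^ 2) * cosh_sq x + cosh_sq s
    linarith [sq_nonneg (sinh s * sin φ)]
  suffices cosh (shiftDist r s φ) ≤ cosh (τ + |r - x|) by
    rwa [cosh_le_cosh, abs_of_nonneg (shiftDist_nonneg hr hs φ), abs_of_nonneg (by positivity)]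
      at this
  calc cosh (shiftDist r s φ) ≤ cosh τ * cosh (r - x) + |w| * |sinh (r - x)| := by
        rw [hcosh, ← abs_mul]
        gcongr
        exact le_abs_self _
    _ ≤ cosh τ * cosh (r - x) + sinh τ * |sinh (r - x)| := by gcongr
    _ = cosh (τ + |r - x|) := by rw [cosh_add, cosh_abs, abs_sinh]

theorem abs_shiftDist_sub_shiftDist_le (hr : 0 ≤ r) (hx : 0 ≤ x) (hs : 0 ≤ s) (φ : ℝ) :
    |shiftDist r s φ - shiftDist x s φ| ≤ |r - x| := by
  have hrx := shiftDist_le_add_abs_sub hr hx hs φ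
  have hxr := shiftDist_le_add_abs_sub hx hr hs φ
  rw [abs_sub_comm x r] at hxr
  exact abs_sub_le_iff.2 ⟨by linarith, by linarith⟩

theorem abs_shiftDist_sub_le (hx : 0 ≤ x) (hs : 0 ≤ s) (φ : ℝ) : |shiftDist x s φ - x| ≤ s := by
  have h := abs_shiftDist_sub_shiftDist_le hs le_rfl hx φ
  rwa [shiftDist_zero_left hx, sub_zero, abs_of_nonneg hs, shiftDist_comm] at h

end HyperbolicDistance

section HyperbolicEstimates

variable {β a b R : ℝ}

theorem cosh_le_cosh_one (hR : 0 ≤ R) (hR1 : R ≤ 1) : cosh R ≤ cosh 1 := by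
  rwa [cosh_le_cosh, abs_of_nonneg hR, abs_one]

theorem mul_cosh_div_sinh_le (hR : 0 < R) (hR1 : R ≤ 1) (hb : R ≤ b) :
    R * (cosh b / sinh b) ≤ cosh 1 := by
  have hsinh : 0 < sinh b := sinh_pos_iff.2 (hR.trans_le hb)
  have hsub : 0 ≤ sinh b * cosh R - cosh b * sinh R := by
    rw [← sinh_sub]; exact sinh_nonneg_iff.2 (by linarith)
  rw [← mul_div_assoc, div_le_iff₀ hsinh]
  calc R * cosh b ≤ sinh R * cosh b := by gcongr; exact self_le_sinh_iff.2 hR.le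
    _ ≤ cosh R * sinh b := by linarith
    _ ≤ cosh 1 * sinh b := by gcongr; exact cosh_le_cosh_one hR.le hR1

theorem sinh_le_of_le_add (hR : 0 < R) (hR1 : R ≤ 1) (ha : R ≤ a) (hab : b ≤ a + R) :
    sinh b ≤ 2 * cosh 1 * sinh a := by
  have hsub : 0 ≤ sinh a * cosh R - cosh a * sinh R := by
    rw [← sinh_sub]; exact sinh_nonneg_iff.2 (by linarith)
  have hsinh : 0 ≤ sinh a := sinh_nonneg_iff.2 (by linarith)
  calc sinh b ≤ sinh (a + R) := sinh_le_sinh.2 hab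
    _ ≤ 2 * (cosh R * sinh a) := by rw [sinh_add]; linarith
    _ ≤ 2 * (cosh 1 * sinh a) := by gcongr; exact cosh_le_cosh_one hR.le hR1
    _ = 2 * cosh 1 * sinh a := by ring

theorem cosh_le_of_le_add (hR : 0 ≤ R) (hR1 : R ≤ 1) (hb : 0 ≤ b) (hab : b ≤ a + R) :
    cosh b ≤ 2 * cosh 1 * cosh a := by
  have hsub : 0 ≤ cosh a * cosh R - sinh a * sinh R := by
    rw [← cosh_sub]; exact (cosh_pos _).le
  have := cosh_pos a
  calc cosh b ≤ cosh (a + R) := by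
        rwa [cosh_le_cosh, abs_of_nonneg hb, abs_of_nonneg (hb.trans hab)]
    _ ≤ 2 * (cosh R * cosh a) := by rw [cosh_add]; linarith
    _ ≤ 2 * (cosh 1 * cosh a) := by gcongr; exact cosh_le_cosh_one hR hR1
    _ = 2 * cosh 1 * cosh a := by ring

theorem abs_sinh_rpow_neg_sub_le (hβ : 0 ≤ β) (hR : 0 < R) (hR1 : R ≤ 1) (ha : R ≤ a)
    (hb : R ≤ b) (hab : |a - b| ≤ R) :
    |sinh a ^ (-β) - sinh b ^ (-β)| ≤
      β * (2 * cosh 1) ^ (β + 2) * (cosh b / sinh b * sinh b ^ (-β)) * |a - b| := by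
  have hc : 0 < 2 * cosh 1 := by positivity
  have hsinh : 0 < sinh b := sinh_pos_iff.2 (hR.trans_le hb)
  have hderiv : ∀ s ∈ Icc (b - R) (b + R) ∩ Ici R, HasDerivWithinAt (fun s => sinh s ^ (-β))
      (cosh s * -β * sinh s ^ (-β - 1)) (Icc (b - R) (b + R) ∩ Ici R) s := fun s hs =>
    ((hasDerivAt_sinh s).rpow_const
      (Or.inl (sinh_pos_iff.2 (hR.trans_le hs.2)).ne')).hasDerivWithinAt
  refine ((convex_Icc _ _).inter (convex_Ici R)).norm_image_sub_le_of_norm_hasDerivWithin_le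
    hderiv (fun s ⟨⟨hbs, hsb⟩, hRs⟩ => ?_) ⟨⟨by linarith, by linarith⟩, hb⟩
    ⟨⟨by linarith [(abs_le.1 hab).1], by linarith [(abs_le.1 hab).2]⟩, ha⟩
  have hs : 0 < sinh s := sinh_pos_iff.2 (hR.trans_le hRs)
  have hcosh : cosh s ≤ 2 * cosh 1 * cosh b :=
    cosh_le_of_le_add hR.le hR1 (hR.le.trans hRs) hsb
  have hrpow : sinh s ^ (-β - 1) ≤ (2 * cosh 1) ^ (β + 1) * sinh b ^ (-β - 1) :=
    calc sinh s ^ (-β - 1) ≤ (sinh b / (2 * cosh 1)) ^ (-β - 1) := by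
          refine rpow_le_rpow_of_nonpos (by positivity) ?_ (by linarith)
          rw [div_le_iff₀' hc]
          exact sinh_le_of_le_add hR hR1 hRs (by linarith)
      _ = (2 * cosh 1) ^ (β + 1) * sinh b ^ (-β - 1) := by
          rw [div_rpow hsinh.le hc.le, ← neg_add', rpow_neg hc.le, div_inv_eq_mul, mul_comm]
  calc ‖cosh s * -β * sinh s ^ (-β - 1)‖ = β * sinh s ^ (-β - 1) * cosh s := by
        rw [norm_mul, norm_mul, norm_neg, norm_of_nonneg (cosh_pos s).le, norm_of_nonneg hβ,
          norm_of_nonneg (rpow_nonneg hs.le _)]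
        ring
    _ ≤ β * ((2 * cosh 1) ^ (β + 1) * sinh b ^ (-β - 1)) * (2 * cosh 1 * cosh b) := by gcongr
    _ = β * (2 * cosh 1) ^ (β + 2) * (cosh b / sinh b * sinh b ^ (-β)) := by
        rw [rpow_sub_one hsinh.ne', show β + 2 = β + 1 + 1 by ring, rpow_add_one hc.ne' (β + 1)]
        ring

end HyperbolicEstimates

section MeasureOfIntervals

variable {lam a r R : ℝ}

theorem setLIntegral_gegenbauerMeasure (lam : ℝ) {s : Set ℝ} (hs : MeasurableSet s)
    (k : ℝ → ℝ≥0∞) :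
    ∫⁻ t in s, k t ∂(gegenbauerMeasure lam) =
      ∫⁻ t in s ∩ Ioi 0, ENNReal.ofReal (sinh t ^ (2 * lam)) * k t := by
  rw [← lintegral_indicator hs, lintegral_gegenbauerMeasure, ← Measure.restrict_restrict hs,
    ← lintegral_indicator hs]
  simp only [indicator_mul_right]

theorem setLIntegral_Ioo_cosh_mul_sinh_rpow (ha : 0 < a) (hR : 0 ≤ R) :
    ∫⁻ t in Ioo 0 R, ENNReal.ofReal (cosh t) * ENNReal.ofReal (sinh t ^ (a - 1)) =
      ENNReal.ofReal (sinh R ^ a / a) := by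
  have hsinh : 0 ≤ sinh R := sinh_nonneg_iff.2 hR
  have himage : sinh '' Ioo 0 R = Ioo 0 (sinh R) := by
    simpa using sinhOrderIso.image_Ioo 0 R
  have hint : IntervalIntegrable (fun u : ℝ => u ^ (a - 1)) volume 0 (sinh R) :=
    intervalIntegral.intervalIntegrable_rpow' (by linarith)
  rw [← lintegral_image_sinh measurableSet_Ioo fun u => ENNReal.ofReal (u ^ (a - 1)), himage,
    restrict_Ioo_eq_restrict_Ioc, ← ofReal_integral_eq_lintegral_ofReal hint.1,
    ← intervalIntegral.integral_of_le hsinh, integral_rpow (Or.inl (by linarith))]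
  · simp [ha.ne']
  · filter_upwards [ae_restrict_mem measurableSet_Ioc] with u hu
    exact rpow_nonneg hu.1.le _

theorem setLIntegral_Ici_cosh_mul_sinh_rpow_neg_two (hR : 0 < R) :
    ∫⁻ t in Ici R, ENNReal.ofReal (cosh t) * ENNReal.ofReal (sinh t ^ (-2 : ℝ)) =
      ENNReal.ofReal (1 / sinh R) := by
  have hsinh : 0 < sinh R := sinh_pos_iff.2 hR
  have himage : sinh '' Ici R = Ici (sinh R) := by
    simpa using sinhOrderIso.image_Ici R
  rw [← lintegral_image_sinh measurableSet_Ici fun u => ENNReal.ofReal (u ^ (-2 : ℝ)), himage,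
    ← restrict_Ioi_eq_restrict_Ici,
    ← ofReal_integral_eq_lintegral_ofReal (integrableOn_Ioi_rpow_of_lt (by norm_num) hsinh),
    integral_Ioi_rpow_of_lt (by norm_num) hsinh]
  · norm_num [rpow_neg_one]
  · filter_upwards [ae_restrict_mem measurableSet_Ioi] with u hu
    exact rpow_nonneg (hsinh.trans hu).le _

theorem measurableSet_gegenbauerInterval (x r : ℝ) : MeasurableSet (gegenbauerInterval x r) :=
  measurableSet_Ioo.inter measurableSet_Ici

theorem gegenbauerMeasure_gegenbauerInterval_zero (lam r : ℝ) :
    gegenbauerMeasure lam (gegenbauerInterval 0 r) =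
      ∫⁻ t in Ioo 0 r, ENNReal.ofReal (sinh t ^ (2 * lam)) := by
  have hset : gegenbauerInterval 0 r ∩ Ioi 0 = Ioo 0 r := by
    ext t
    simp only [gegenbauerInterval, mem_inter_iff, mem_Ioo, mem_Ici, mem_Ioi]
    constructor
    · rintro ⟨⟨⟨-, htr⟩, -⟩, ht⟩; exact ⟨ht, by linarith⟩
    · rintro ⟨ht, htr⟩; exact ⟨⟨⟨by linarith, by linarith⟩, ht.le⟩, ht⟩
  have h := setLIntegral_gegenbauerMeasure lam (measurableSet_gegenbauerInterval 0 r) 1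
  simpa only [Pi.one_apply, setLIntegral_one, mul_one, hset] using h

theorem gegenbauerMeasure_Iio_le (hlam : 0 < lam) (hr : 0 ≤ r) :
    gegenbauerMeasure lam (Iio r) ≤ ENNReal.ofReal (sinh r ^ (2 * lam + 1) / (2 * lam + 1)) := by
  rw [← setLIntegral_one, setLIntegral_gegenbauerMeasure lam measurableSet_Iio, Iio_inter_Ioi,
    ← setLIntegral_Ioo_cosh_mul_sinh_rpow (by linarith) hr]
  refine lintegral_mono fun t => ?_
  rw [mul_one, add_sub_cancel_right]
  exact le_mul_of_one_le_left zero_le (ENNReal.one_le_ofReal.2 (one_le_cosh t))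

theorem le_gegenbauerMeasure_gegenbauerInterval_zero (hlam : 0 < lam) (hR : 0 < R) (hR1 : R ≤ 1)
    (hRr : R ≤ r) :
    ENNReal.ofReal (sinh R ^ (2 * lam + 1) / (2 * lam + 1)) ≤
      ENNReal.ofReal (cosh 1) * gegenbauerMeasure lam (gegenbauerInterval 0 r) := by
  rw [gegenbauerMeasure_gegenbauerInterval_zero,
    ← setLIntegral_Ioo_cosh_mul_sinh_rpow (by linarith) hR.le,
    ← lintegral_const_mul _ (by fun_prop)]
  refine (setLIntegral_mono' measurableSet_Ioo fun t ht => ?_).trans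
    (lintegral_mono_set (Ioo_subset_Ioo_right hRr))
  rw [add_sub_cancel_right]
  gcongr ENNReal.ofReal ?_ * _
  exact cosh_le_cosh_one ht.1.le (ht.2.le.trans hR1)

theorem isFiniteMeasure_restrict_gegenbauerInterval_zero (hlam : 0 < lam) (r : ℝ) :
    IsFiniteMeasure ((gegenbauerMeasure lam).restrict (gegenbauerInterval 0 r)) := by
  refine isFiniteMeasure_restrict.2 (ne_top_of_le_ne_top ?_
    (measure_mono (inter_subset_left.trans (Ioo_subset_Iio_self.trans
      (Iio_subset_Iio (le_max_left (0 + r) 0))))))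
  exact ((gegenbauerMeasure_Iio_le hlam (le_max_right _ _)).trans_lt ENNReal.ofReal_lt_top).ne

end MeasureOfIntervals

section Kernels

variable {lam β q r x s t R : ℝ}

/-- The kernel `(sinh x)^{-β}` truncated at height `(sinh R)^{-β}`, as a function of `cosh x`. For
`R = 0` nothing is truncated. -/
noncomputable def truncKernel (β R y : ℝ) : ℝ :=
  max √(y ^ 2 - 1) (sinh R) ^ (-β)

/-- The function `R coth(x) (sinh x)^{-β}` of `cosh x`, with `x` replaced by `R` for `x < R`. Up to
a constant, it bounds the oscillation of `truncKernel β R` at distance `R`. -/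
noncomputable def kernelMajorant (β R y : ℝ) : ℝ :=
  R * (√(1 + max √(y ^ 2 - 1) (sinh R) ^ 2) / max √(y ^ 2 - 1) (sinh R)) * truncKernel β R y

/-- The part of the kernel `(sinh x)^{-β}` removed by truncation at `R`. -/
noncomputable def kernelGap (β R y : ℝ) : ℝ≥0∞ :=
  ‖truncKernel β 0 y - truncKernel β R y‖ₑ

@[fun_prop]
theorem measurable_truncKernel (β R : ℝ) : Measurable (truncKernel β R) := by
  unfold truncKernel; fun_prop

@[fun_prop]
theorem measurable_kernelMajorant (β R : ℝ) : Measurable (kernelMajorant β R) := by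
  unfold kernelMajorant; fun_prop

@[fun_prop]
theorem measurable_kernelGap (β R : ℝ) : Measurable (kernelGap β R) := by
  unfold kernelGap; fun_prop

theorem rieszGegenbauerKernel_eq_truncKernel (lam α : ℝ) :
    rieszGegenbauerKernel lam α = truncKernel (2 * lam + 1 - α) 0 := by
  ext y
  rw [rieszGegenbauerKernel, truncKernel, sinh_zero, max_eq_left (sqrt_nonneg _)]
  ring_nf

theorem max_sqrt_cosh_sq_sub_one (ht : 0 ≤ t) (R : ℝ) :
    max √(cosh t ^ 2 - 1) (sinh R) = sinh (max t R) := by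
  rw [sqrt_cosh_sq_sub_one ht]
  exact (sinhOrderIso.monotone.map_max (a := t) (b := R)).symm

theorem truncKernel_cosh (β R : ℝ) (ht : 0 ≤ t) :
    truncKernel β R (cosh t) = sinh (max t R) ^ (-β) := by
  rw [truncKernel, max_sqrt_cosh_sq_sub_one ht]

theorem kernelMajorant_cosh (β R : ℝ) (ht : 0 ≤ t) :
    kernelMajorant β R (cosh t) =
      R * (cosh (max t R) / sinh (max t R)) * sinh (max t R) ^ (-β) := by
  rw [kernelMajorant, truncKernel_cosh β R ht, max_sqrt_cosh_sq_sub_one ht, add_comm 1,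
    ← cosh_sq, sqrt_sq (cosh_pos _).le]

theorem truncKernel_nonneg (β R y : ℝ) : 0 ≤ truncKernel β R y :=
  rpow_nonneg (le_max_of_le_left (sqrt_nonneg _)) _

theorem kernelMajorant_nonneg (β : ℝ) (hR : 0 ≤ R) (y : ℝ) : 0 ≤ kernelMajorant β R y := by
  have : 0 ≤ max √(y ^ 2 - 1) (sinh R) := le_max_of_le_left (sqrt_nonneg _)
  have hK := truncKernel_nonneg β R y
  unfold kernelMajorant
  positivity

theorem mul_truncKernel_le_kernelMajorant (β : ℝ) (hR : 0 < R) (y : ℝ) :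
    R * truncKernel β R y ≤ kernelMajorant β R y := by
  have hmax : 0 < max √(y ^ 2 - 1) (sinh R) := lt_max_of_lt_right (sinh_pos_iff.2 hR)
  have hone : 1 ≤ √(1 + max √(y ^ 2 - 1) (sinh R) ^ 2) / max √(y ^ 2 - 1) (sinh R) := by
    rw [one_le_div hmax]
    exact le_sqrt_of_sq_le (by linarith)
  exact mul_le_mul_of_nonneg_right (le_mul_of_one_le_right hR.le hone) (truncKernel_nonneg β R y)

theorem abs_truncKernel_shiftPoint_sub_le (hβ : 0 ≤ β) (hR : 0 < R) (hR1 : R ≤ 1) (hr : 0 ≤ r)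
    (hx : 0 ≤ x) (hs : 0 ≤ s) (hrx : |r - x| ≤ R) (φ : ℝ) :
    |truncKernel β R (shiftPoint (cosh r) (cosh s) φ) -
        truncKernel β R (shiftPoint (cosh x) (cosh s) φ)| ≤
      β * (2 * cosh 1) ^ (β + 2) * kernelMajorant β R (shiftPoint (cosh x) (cosh s) φ) := by
  have hτ := shiftDist_nonneg hx hs φ
  rw [← cosh_shiftDist hr hs, ← cosh_shiftDist hx hs, truncKernel_cosh _ _ hτ,
    truncKernel_cosh _ _ (shiftDist_nonneg hr hs φ), kernelMajorant_cosh _ _ hτ]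
  set a := max (shiftDist r s φ) R
  set b := max (shiftDist x s φ) R
  have hab : |a - b| ≤ R := ((abs_max_sub_max_le_abs _ _ _).trans
    (abs_shiftDist_sub_shiftDist_le hr hx hs φ)).trans hrx
  have : 0 < sinh b := sinh_pos_iff.2 (lt_max_of_lt_right hR)
  calc |sinh a ^ (-β) - sinh b ^ (-β)|
      ≤ β * (2 * cosh 1) ^ (β + 2) * (cosh b / sinh b * sinh b ^ (-β)) * |a - b| :=
        abs_sinh_rpow_neg_sub_le hβ hR hR1 (le_max_right _ _) (le_max_right _ _) hab
    _ ≤ β * (2 * cosh 1) ^ (β + 2) * (cosh b / sinh b * sinh b ^ (-β)) * R := by gcongr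
    _ = β * (2 * cosh 1) ^ (β + 2) * (R * (cosh b / sinh b) * sinh b ^ (-β)) := by ring

theorem kernelGap_cosh_of_le (β : ℝ) (hR : 0 ≤ R) (hRt : R ≤ t) : kernelGap β R (cosh t) = 0 := by
  have ht : 0 ≤ t := hR.trans hRt
  rw [kernelGap, truncKernel_cosh _ _ ht, truncKernel_cosh _ _ ht, max_eq_left ht,
    max_eq_left hRt, sub_self, enorm_zero]

theorem kernelGap_cosh_le (hβ : 0 ≤ β) (ht : 0 < t) (R : ℝ) :
    kernelGap β R (cosh t) ≤ ENNReal.ofReal (sinh t ^ (-β)) := by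
  rw [kernelGap, truncKernel_cosh _ _ ht.le, truncKernel_cosh _ _ ht.le, max_eq_left ht.le,
    enorm_eq_ofReal_abs]
  have hanti : sinh (max t R) ^ (-β) ≤ sinh t ^ (-β) :=
    rpow_le_rpow_of_nonpos (sinh_pos_iff.2 ht) (sinh_le_sinh.2 (le_max_left _ _)) (by linarith)
  have hnonneg : 0 ≤ sinh (max t R) ^ (-β) :=
    rpow_nonneg (sinh_nonneg_iff.2 (ht.le.trans (le_max_left _ _))) _
  refine ENNReal.ofReal_le_ofReal ?_
  rw [abs_of_nonneg (by linarith)]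
  linarith

theorem lintegral_kernelGap_le (hβ : 0 ≤ β) (hβlam : β < 2 * lam + 1) (hR : 0 ≤ R) :
    ∫⁻ t, kernelGap β R (cosh t) ∂(gegenbauerMeasure lam) ≤
      ENNReal.ofReal (sinh R ^ (2 * lam + 1 - β) / (2 * lam + 1 - β)) := by
  have hfar : ∫⁻ t in Ioi 0 \ Iio R,
      ENNReal.ofReal (sinh t ^ (2 * lam)) * kernelGap β R (cosh t) = 0 :=
    setLIntegral_eq_zero (measurableSet_Ioi.diff measurableSet_Iio) fun t ht => by
      rw [kernelGap_cosh_of_le β hR (not_lt.1 ht.2), mul_zero, Pi.zero_apply]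
  rw [lintegral_gegenbauerMeasure, ← lintegral_inter_add_sdiff _ _ measurableSet_Iio, hfar,
    add_zero, Ioi_inter_Iio, ← setLIntegral_Ioo_cosh_mul_sinh_rpow (by linarith) hR]
  refine setLIntegral_mono' measurableSet_Ioo fun t ht => ?_
  have hsinh : 0 < sinh t := sinh_pos_iff.2 ht.1
  calc ENNReal.ofReal (sinh t ^ (2 * lam)) * kernelGap β R (cosh t)
      ≤ ENNReal.ofReal (sinh t ^ (2 * lam)) * ENNReal.ofReal (sinh t ^ (-β)) := by
        gcongr
        exact kernelGap_cosh_le hβ ht.1 R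
    _ = ENNReal.ofReal (sinh t ^ (2 * lam + 1 - β - 1)) := by
        rw [← ENNReal.ofReal_mul (by positivity), ← rpow_add hsinh]
        ring_nf
    _ ≤ ENNReal.ofReal (cosh t) * ENNReal.ofReal (sinh t ^ (2 * lam + 1 - β - 1)) :=
        le_mul_of_one_le_left zero_le (ENNReal.one_le_ofReal.2 (one_le_cosh t))

theorem kernelMajorant_cosh_rpow (hβq : β * q = 2 * lam + 1) (hR : 0 < R) (ht : 0 ≤ t) :
    kernelMajorant β R (cosh t) ^ q =
      (R * (cosh (max t R) / sinh (max t R))) ^ q * sinh (max t R) ^ (-(2 * lam + 1)) := by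
  have hsinh : 0 < sinh (max t R) := sinh_pos_iff.2 (lt_max_of_lt_right hR)
  rw [kernelMajorant_cosh β R ht, mul_rpow (by positivity) (by positivity), ← rpow_mul hsinh.le,
    neg_mul, hβq]

theorem setLIntegral_Iio_kernelMajorant_rpow_le (hlam : 0 < lam) (hq : 0 ≤ q)
    (hβq : β * q = 2 * lam + 1) (hR : 0 < R) (hR1 : R ≤ 1) :
    ∫⁻ t in Iio R, ENNReal.ofReal (kernelMajorant β R (cosh t) ^ q) ∂(gegenbauerMeasure lam) ≤
      ENNReal.ofReal (cosh 1 ^ q / (2 * lam + 1)) := by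
  have hsinh : 0 < sinh R := sinh_pos_iff.2 hR
  have hbound : ∀ᵐ t ∂(gegenbauerMeasure lam).restrict (Iio R),
      ENNReal.ofReal (kernelMajorant β R (cosh t) ^ q) ≤
        ENNReal.ofReal (cosh 1 ^ q * sinh R ^ (-(2 * lam + 1))) := by
    filter_upwards [ae_restrict_of_ae (ae_gegenbauerMeasure_pos lam),
      ae_restrict_mem measurableSet_Iio] with t ht htR
    rw [kernelMajorant_cosh_rpow hβq hR ht.le, max_eq_right (le_of_lt htR)]
    gcongr
    exact mul_cosh_div_sinh_le hR hR1 le_rfl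
  calc ∫⁻ t in Iio R, ENNReal.ofReal (kernelMajorant β R (cosh t) ^ q) ∂(gegenbauerMeasure lam)
      ≤ ENNReal.ofReal (cosh 1 ^ q * sinh R ^ (-(2 * lam + 1))) *
          gegenbauerMeasure lam (Iio R) := by
        rw [← setLIntegral_const]
        exact lintegral_mono_ae hbound
    _ ≤ ENNReal.ofReal (cosh 1 ^ q * sinh R ^ (-(2 * lam + 1))) *
          ENNReal.ofReal (sinh R ^ (2 * lam + 1) / (2 * lam + 1)) := by
        gcongr
        exact gegenbauerMeasure_Iio_le hlam hR.le
    _ = ENNReal.ofReal (cosh 1 ^ q / (2 * lam + 1)) := by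
        rw [← ENNReal.ofReal_mul (by positivity), rpow_neg hsinh.le]
        congr 1
        field_simp

theorem sinh_rpow_mul_kernelMajorant_rpow_le (hq : 1 ≤ q) (hβq : β * q = 2 * lam + 1)
    (hR : 0 < R) (hR1 : R ≤ 1) (hRt : R ≤ t) :
    sinh t ^ (2 * lam) * kernelMajorant β R (cosh t) ^ q ≤
      cosh 1 ^ (q - 1) * R * (cosh t * sinh t ^ (-2 : ℝ)) := by
  have ht : 0 < t := hR.trans_le hRt
  have hsinh : 0 < sinh t := sinh_pos_iff.2 ht
  set κ := R * (cosh t / sinh t) with hκ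
  have hκ_pos : 0 < κ := by positivity
  calc sinh t ^ (2 * lam) * kernelMajorant β R (cosh t) ^ q
      = κ ^ (q - 1) * (κ * (sinh t ^ (2 * lam) * sinh t ^ (-(2 * lam + 1)))) := by
        rw [kernelMajorant_cosh_rpow hβq hR ht.le, max_eq_left hRt, ← hκ,
          rpow_sub_one hκ_pos.ne']
        field_simp
    _ = κ ^ (q - 1) * (R * (cosh t * sinh t ^ (-2 : ℝ))) := by
        rw [← rpow_add hsinh, hκ, show (-2 : ℝ) = 2 * lam + -(2 * lam + 1) - 1 by ring,
          rpow_sub_one hsinh.ne' (2 * lam + -(2 * lam + 1))]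
        ring
    _ ≤ cosh 1 ^ (q - 1) * (R * (cosh t * sinh t ^ (-2 : ℝ))) := by
        gcongr
        exact mul_cosh_div_sinh_le hR hR1 hRt
    _ = cosh 1 ^ (q - 1) * R * (cosh t * sinh t ^ (-2 : ℝ)) := by ring

theorem setLIntegral_Ici_kernelMajorant_rpow_le (hq : 1 ≤ q) (hβq : β * q = 2 * lam + 1)
    (hR : 0 < R) (hR1 : R ≤ 1) :
    ∫⁻ t in Ici R, ENNReal.ofReal (kernelMajorant β R (cosh t) ^ q) ∂(gegenbauerMeasure lam) ≤
      ENNReal.ofReal (cosh 1 ^ (q - 1)) := by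
  have hsinh : 0 < sinh R := sinh_pos_iff.2 hR
  rw [setLIntegral_gegenbauerMeasure lam measurableSet_Ici,
    inter_eq_left.2 (Ici_subset_Ioi.2 hR)]
  calc ∫⁻ t in Ici R, ENNReal.ofReal (sinh t ^ (2 * lam)) *
        ENNReal.ofReal (kernelMajorant β R (cosh t) ^ q)
      ≤ ∫⁻ t in Ici R, ENNReal.ofReal (cosh 1 ^ (q - 1) * R) *
          (ENNReal.ofReal (cosh t) * ENNReal.ofReal (sinh t ^ (-2 : ℝ))) := by
        refine setLIntegral_mono' measurableSet_Ici fun t hRt => ?_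
        have ht : 0 ≤ sinh t := sinh_nonneg_iff.2 (hR.le.trans hRt)
        rw [← ENNReal.ofReal_mul (by positivity), ← ENNReal.ofReal_mul (by positivity),
          ← ENNReal.ofReal_mul (by positivity)]
        exact ENNReal.ofReal_le_ofReal (sinh_rpow_mul_kernelMajorant_rpow_le hq hβq hR hR1 hRt)
    _ = ENNReal.ofReal (cosh 1 ^ (q - 1) * (R / sinh R)) := by
        rw [lintegral_const_mul _ (by fun_prop), setLIntegral_Ici_cosh_mul_sinh_rpow_neg_two hR,
          ← ENNReal.ofReal_mul (by positivity)]
        ring_nf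
    _ ≤ ENNReal.ofReal (cosh 1 ^ (q - 1)) := by
        refine ENNReal.ofReal_le_ofReal (mul_le_of_le_one_right (by positivity) ?_)
        exact (div_le_one hsinh).2 (self_le_sinh_iff.2 hR.le)

/-- A bound for the `L^q` norms of `kernelMajorant β R`, `0 < R ≤ 1`, when `β q = 2λ + 1`. -/
noncomputable def majorantConst (lam q : ℝ) : ℝ≥0∞ :=
  ENNReal.ofReal (cosh 1 ^ q / (2 * lam + 1) + cosh 1 ^ (q - 1)) ^ (1 / q)

theorem eLpNorm'_kernelMajorant_le (hlam : 0 < lam) (hq : 1 ≤ q) (hβq : β * q = 2 * lam + 1)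
    (hR : 0 < R) (hR1 : R ≤ 1) :
    eLpNorm' (fun t => ENNReal.ofReal (kernelMajorant β R (cosh t))) q (gegenbauerMeasure lam) ≤
      majorantConst lam q := by
  have hq0 : 0 ≤ q := zero_le_one.trans hq
  refine ENNReal.rpow_le_rpow ?_ (one_div_nonneg.2 hq0)
  simp only [enorm_eq_self, ENNReal.ofReal_rpow_of_nonneg (kernelMajorant_nonneg β hR.le _) hq0]
  rw [← lintegral_add_compl _ (measurableSet_Iio (a := R)), compl_Iio,
    ENNReal.ofReal_add (by positivity) (by positivity)]
  exact add_le_add (setLIntegral_Iio_kernelMajorant_rpow_le hlam hq0 hβq hR hR1)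
    (setLIntegral_Ici_kernelMajorant_rpow_le hq hβq hR hR1)

end Kernels

section TruncatedOperator

variable {E : Type*} [NormedAddCommGroup E] [NormedSpace ℝ E]
variable {lam β p q r x s R : ℝ} {g : ℝ → E} {h : ℝ → ℝ≥0∞}

/-- The factor multiplying `f (cosh t)` in the modified fractional integral of order
`2 * lam + 1 - β`, with the shifted kernel truncated at `R`. -/
noncomputable def truncWeight (lam β R y t : ℝ) : ℝ :=
  gegenbauerShift lam (cosh t) (truncKernel β R) y -
    (Ioi (1 / 4 : ℝ)).indicator (fun s => sinh s ^ (-β)) t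

/-- The modified fractional integral of order `2 * lam + 1 - β` with its kernel truncated at `R`,
acting on functions of `t` instead of `cosh t`. For `R = 0` it is the modified Riesz-Gegenbauer
integral. -/
noncomputable def truncRiesz (lam β R : ℝ) (g : ℝ → E) (y : ℝ) : E :=
  ∫ t, truncWeight lam β R y t • g t ∂(gegenbauerMeasure lam)

theorem modifiedRieszGegenbauerIntegrand_ae_eq {f g : ℝ → ℂ}
    (hfg : (fun t => f (cosh t)) =ᵐ[gegenbauerMeasure lam] g) (α y : ℝ) :
    modifiedRieszGegenbauerIntegrand lam α f y =ᵐ[gegenbauerMeasure lam]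
      fun t => truncWeight lam (2 * lam + 1 - α) 0 y t • g t := by
  filter_upwards [hfg] with t ht
  rw [modifiedRieszGegenbauerIntegrand, rieszGegenbauerKernel_eq_truncKernel, truncWeight, ht,
    show α - 2 * lam - 1 = -(2 * lam + 1 - α) by ring]

theorem modifiedRieszGegenbauer_eq_truncRiesz {f g : ℝ → ℂ}
    (hfg : (fun t => f (cosh t)) =ᵐ[gegenbauerMeasure lam] g) (α : ℝ) :
    modifiedRieszGegenbauer lam α f = truncRiesz lam (2 * lam + 1 - α) 0 g :=
  funext fun y => integral_congr_ae (modifiedRieszGegenbauerIntegrand_ae_eq hfg α y)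

theorem stronglyMeasurable_gegenbauerShift (hlam : 0 < lam) {f : ℝ → E}
    (hf : StronglyMeasurable f) :
    StronglyMeasurable fun z : ℝ × ℝ => gegenbauerShift lam (cosh z.2) f z.1 := by
  simp only [gegenbauerShift_eq_integral hlam]
  exact StronglyMeasurable.integral_prod_right'
    (f := fun w : (ℝ × ℝ) × ℝ => f (shiftPoint w.1.1 (cosh w.1.2) w.2))
    (hf.comp_measurable (by fun_prop))

theorem stronglyMeasurable_gegenbauerShift_cosh (hlam : 0 < lam) {f : ℝ → E}
    (hf : StronglyMeasurable f) (v : ℝ) :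
    StronglyMeasurable fun t => gegenbauerShift lam (cosh t) f v :=
  (stronglyMeasurable_gegenbauerShift hlam hf).comp_measurable measurable_prodMk_left

theorem measurable_truncWeight (hlam : 0 < lam) (β R : ℝ) :
    Measurable fun z : ℝ × ℝ => truncWeight lam β R z.1 z.2 :=
  (stronglyMeasurable_gegenbauerShift hlam
    (measurable_truncKernel β R).stronglyMeasurable).measurable.sub
    (((measurable_sinh.pow_const _).indicator measurableSet_Ioi).comp measurable_snd)

theorem stronglyMeasurable_truncWeight_smul (hlam : 0 < lam) (hg : StronglyMeasurable g)
    (β R y : ℝ) : StronglyMeasurable fun t => truncWeight lam β R y t • g t :=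
  ((measurable_truncWeight hlam β R).comp measurable_prodMk_left).stronglyMeasurable.smul hg

theorem stronglyMeasurable_truncRiesz (hlam : 0 < lam) (hg : StronglyMeasurable g) (β R : ℝ) :
    StronglyMeasurable (truncRiesz lam β R g) :=
  ((measurable_truncWeight hlam β R).stronglyMeasurable.smul
    (hg.comp_measurable measurable_snd)).integral_prod_right'

theorem integrable_truncKernel_shiftPoint (hlam : 0 < lam) (hβ : 0 ≤ β) (hr : 0 ≤ r) (hs : 0 ≤ s)
    (hsr : s ≠ r) (R : ℝ) :
    Integrable (fun φ => truncKernel β R (shiftPoint (cosh r) (cosh s) φ)) (angleMeasure lam) := by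
  have := isProbabilityMeasure_angleMeasure hlam
  refine Integrable.of_bound (Measurable.aestronglyMeasurable (by fun_prop)) (sinh |r - s| ^ (-β))
    (.of_forall fun φ => ?_)
  have hdist : |r - s| ≤ max (shiftDist r s φ) R :=
    (abs_sub_le_shiftDist hr hs φ).trans (le_max_left _ _)
  rw [norm_of_nonneg (truncKernel_nonneg _ _ _), ← cosh_shiftDist hr hs,
    truncKernel_cosh _ _ (shiftDist_nonneg hr hs φ)]
  exact rpow_le_rpow_of_nonpos (sinh_pos_iff.2 (abs_pos.2 (sub_ne_zero.2 hsr.symm)))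
    (sinh_le_sinh.2 hdist) (neg_nonpos.2 hβ)

theorem enorm_truncWeight_sub_le (hlam : 0 < lam) (hβ : 0 ≤ β) (hr : 0 ≤ r) (hx : 0 ≤ x)
    (hs : 0 ≤ s) (hsr : s ≠ r) (hsx : s ≠ x) (R R' : ℝ) :
    ‖truncWeight lam β R (cosh r) s - truncWeight lam β R' (cosh x) s‖ₑ ≤
      ∫⁻ φ, ‖truncKernel β R (shiftPoint (cosh r) (cosh s) φ) -
        truncKernel β R' (shiftPoint (cosh x) (cosh s) φ)‖ₑ ∂(angleMeasure lam) := by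
  rw [truncWeight, truncWeight, sub_sub_sub_cancel_right, gegenbauerShift_eq_integral hlam,
    gegenbauerShift_eq_integral hlam,
    ← integral_sub (integrable_truncKernel_shiftPoint hlam hβ hr hs hsr R)
      (integrable_truncKernel_shiftPoint hlam hβ hx hs hsx R')]
  exact enorm_integral_le_lintegral_enorm _

theorem enorm_truncKernel_le (β : ℝ) (hR : 0 < R) (y : ℝ) :
    ‖truncKernel β R y‖ₑ ≤
      ENNReal.ofReal R⁻¹ * ENNReal.ofReal (kernelMajorant β R y) := by
  rw [enorm_eq_ofReal (truncKernel_nonneg β R y), ← ENNReal.ofReal_mul (by positivity)]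
  refine ENNReal.ofReal_le_ofReal ?_
  rw [← div_eq_inv_mul, le_div_iff₀' hR]
  exact mul_truncKernel_le_kernelMajorant β hR y

theorem enorm_indicator_sinh_rpow_le (β s : ℝ) :
    ‖(Ioi (1 / 4 : ℝ)).indicator (fun s => sinh s ^ (-β)) s‖ₑ ≤
      4 * ENNReal.ofReal (kernelMajorant β (1 / 4) (cosh s)) := by
  by_cases hs : 1 / 4 < s
  · have hK := enorm_truncKernel_le β (R := 1 / 4) (by norm_num) (cosh s)
    rw [truncKernel_cosh _ _ (by linarith), max_eq_left hs.le] at hK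
    rw [indicator_of_mem (mem_Ioi.2 hs)]
    simpa using hK
  · rw [indicator_of_notMem (notMem_Ioi.2 (not_lt.1 hs)), enorm_zero]
    exact zero_le

theorem enorm_truncWeight_le (hlam : 0 < lam) (hR : 0 < R) (β y s : ℝ) :
    ‖truncWeight lam β R y s‖ₑ ≤
      ENNReal.ofReal R⁻¹ *
          lshift lam (cosh s) (fun y => ENNReal.ofReal (kernelMajorant β R y)) y +
        4 * ENNReal.ofReal (kernelMajorant β (1 / 4) (cosh s)) := by
  refine enorm_sub_le.trans (add_le_add ?_ (enorm_indicator_sinh_rpow_le β s))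
  rw [gegenbauerShift_eq_integral hlam, ← lshift_const_mul _ _ _ _ (by fun_prop)]
  exact (enorm_integral_le_lintegral_enorm _).trans
    (lintegral_mono fun φ => enorm_truncKernel_le β hR _)

theorem shiftConv_kernelMajorant_le (hlam : 0 < lam) (hpq : p.HolderConjugate q)
    (hβq : β * q = 2 * lam + 1) (hR : 0 < R) (hR1 : R ≤ 1) (hh : Measurable h) (hx : 0 ≤ x) :
    shiftConv lam (fun y => ENNReal.ofReal (kernelMajorant β R y)) h (cosh x) ≤
      majorantConst lam q * eLpNorm' h p (gegenbauerMeasure lam) := by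
  refine (shiftConv_cosh_le hlam hpq (by fun_prop) hh hx).trans ?_
  gcongr
  exact eLpNorm'_kernelMajorant_le hlam hpq.symm.lt.le hβq hR hR1

theorem majorantConst_ne_top (hq : 0 ≤ q) (lam : ℝ) : majorantConst lam q ≠ ⊤ :=
  ENNReal.rpow_ne_top_of_nonneg (one_div_nonneg.2 hq) ENNReal.ofReal_ne_top

theorem integrable_truncWeight_smul (hlam : 0 < lam) (hpq : p.HolderConjugate q)
    (hβq : β * q = 2 * lam + 1) (hR : 0 < R) (hR1 : R ≤ 1) (hg : StronglyMeasurable g)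
    (hgp : eLpNorm' g p (gegenbauerMeasure lam) < ⊤) (hr : 0 ≤ r) :
    Integrable (fun t => truncWeight lam β R (cosh r) t • g t) (gegenbauerMeasure lam) := by
  refine ⟨(stronglyMeasurable_truncWeight_smul hlam hg β R _).aestronglyMeasurable, ?_⟩
  set k : ℝ → ℝ → ℝ≥0∞ := fun ρ y => ENNReal.ofReal (kernelMajorant β ρ y)
  have hh : Measurable fun t => ‖g t‖ₑ := hg.enorm
  have hconv : ∀ ρ, 0 < ρ → ρ ≤ 1 → ∀ r, 0 ≤ r →
      shiftConv lam (k ρ) (fun t => ‖g t‖ₑ) (cosh r) < ⊤ :=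
    fun ρ hρ hρ1 r hr => (shiftConv_kernelMajorant_le hlam hpq hβq hρ hρ1 hh hr).trans_lt
      (ENNReal.mul_lt_top (majorantConst_ne_top hpq.symm.nonneg lam).lt_top
        (by simpa [eLpNorm'] using hgp))
  calc ∫⁻ t, ‖truncWeight lam β R (cosh r) t • g t‖ₑ ∂(gegenbauerMeasure lam)
      ≤ ∫⁻ t, (ENNReal.ofReal R⁻¹ * (lshift lam (cosh t) (k R) (cosh r) * ‖g t‖ₑ) +
          4 * (lshift lam (cosh t) (k (1 / 4)) (cosh 0) * ‖g t‖ₑ)) ∂(gegenbauerMeasure lam) := by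
        refine lintegral_mono fun t => ?_
        rw [enorm_smul, cosh_zero, lshift_one_right hlam, ← mul_assoc, ← mul_assoc, ← add_mul]
        gcongr
        exact enorm_truncWeight_le hlam hR β (cosh r) t
    _ = ENNReal.ofReal R⁻¹ * shiftConv lam (k R) (fun t => ‖g t‖ₑ) (cosh r) +
          4 * shiftConv lam (k (1 / 4)) (fun t => ‖g t‖ₑ) (cosh 0) := by
        rw [lintegral_add_left (by fun_prop), lintegral_const_mul _ (by fun_prop),
          lintegral_const_mul _ (by fun_prop)]
        rfl
    _ < ⊤ := ENNReal.add_lt_top.2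
        ⟨ENNReal.mul_lt_top ENNReal.ofReal_lt_top (hconv R hR hR1 r hr),
          ENNReal.mul_lt_top ENNReal.ofNat_lt_top (hconv _ (by norm_num) (by norm_num) 0 le_rfl)⟩

end TruncatedOperator

section Oscillation

variable {E : Type*} [NormedAddCommGroup E] [NormedSpace ℝ E]
variable {lam β p q r x d R : ℝ} {g : ℝ → E} {h : ℝ → ℝ≥0∞}

theorem kernelExponent_pos (hlam : 0 < lam) (hpq : p.HolderConjugate q)
    (hβq : β * q = 2 * lam + 1) : 0 < β :=
  pos_of_mul_pos_left (by linarith) hpq.symm.nonneg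

theorem sub_kernelExponent_eq_div (hpq : p.HolderConjugate q) (hβq : β * q = 2 * lam + 1) :
    2 * lam + 1 - β = (2 * lam + 1) / p := by
  rw [div_eq_mul_inv, ← hpq.symm.one_sub_inv, ← hβq, mul_sub, mul_one,
    mul_inv_cancel_right₀ hpq.symm.ne_zero]

theorem lintegral_enorm_truncWeight_sub_mul_le (hlam : 0 < lam) (hpq : p.HolderConjugate q)
    (hβq : β * q = 2 * lam + 1) (hR : 0 < R) (hR1 : R ≤ 1) (hh : Measurable h) (hr : 0 ≤ r)
    (hx : 0 ≤ x) (hrx : |r - x| ≤ R) :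
    ∫⁻ s, ‖truncWeight lam β R (cosh r) s - truncWeight lam β R (cosh x) s‖ₑ * h s
        ∂(gegenbauerMeasure lam) ≤
      ENNReal.ofReal (β * (2 * cosh 1) ^ (β + 2)) *
        (majorantConst lam q * eLpNorm' h p (gegenbauerMeasure lam)) := by
  have hβ := kernelExponent_pos hlam hpq hβq
  set k : ℝ → ℝ≥0∞ := fun y => ENNReal.ofReal (kernelMajorant β R y) with hk
  calc ∫⁻ s, ‖truncWeight lam β R (cosh r) s - truncWeight lam β R (cosh x) s‖ₑ * h s
        ∂(gegenbauerMeasure lam)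
      ≤ ∫⁻ s, ENNReal.ofReal (β * (2 * cosh 1) ^ (β + 2)) *
          (lshift lam (cosh s) k (cosh x) * h s) ∂(gegenbauerMeasure lam) := by
        refine lintegral_mono_ae ?_
        filter_upwards [ae_gegenbauerMeasure_pos lam, ae_gegenbauerMeasure_ne lam r,
          ae_gegenbauerMeasure_ne lam x] with s hs hsr hsx
        rw [← mul_assoc, ← lshift_const_mul _ _ _ _ (by fun_prop)]
        gcongr
        refine (enorm_truncWeight_sub_le hlam hβ.le hr hx hs.le hsr hsx R R).trans
          (lintegral_mono fun φ => ?_)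
        rw [enorm_eq_ofReal_abs]
        simp only [hk, ← ENNReal.ofReal_mul (by positivity : 0 ≤ β * (2 * cosh 1) ^ (β + 2))]
        exact ENNReal.ofReal_le_ofReal
          (abs_truncKernel_shiftPoint_sub_le hβ.le hR hR1 hr hx hs.le hrx φ)
    _ = ENNReal.ofReal (β * (2 * cosh 1) ^ (β + 2)) * shiftConv lam k h (cosh x) :=
        lintegral_const_mul _ (by fun_prop)
    _ ≤ ENNReal.ofReal (β * (2 * cosh 1) ^ (β + 2)) *
          (majorantConst lam q * eLpNorm' h p (gegenbauerMeasure lam)) := by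
        gcongr
        exact shiftConv_kernelMajorant_le hlam hpq hβq hR hR1 hh hx

theorem lintegral_enorm_truncWeight_one_sub_mul_le (hlam : 0 < lam) (hpq : p.HolderConjugate q)
    (hβq : β * q = 2 * lam + 1) (hh : Measurable h) (hr : 0 ≤ r) (hx : 0 ≤ x) :
    ∫⁻ s, ‖truncWeight lam β 1 (cosh r) s - truncWeight lam β 1 (cosh x) s‖ₑ * h s
        ∂(gegenbauerMeasure lam) ≤
      2 * (majorantConst lam q * eLpNorm' h p (gegenbauerMeasure lam)) := by
  have hβ := kernelExponent_pos hlam hpq hβq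
  set k : ℝ → ℝ≥0∞ := fun y => ENNReal.ofReal (kernelMajorant β 1 y)
  have hK (y : ℝ) : ‖truncKernel β 1 y‖ₑ ≤ k y := by simpa using enorm_truncKernel_le β one_pos y
  calc ∫⁻ s, ‖truncWeight lam β 1 (cosh r) s - truncWeight lam β 1 (cosh x) s‖ₑ * h s
        ∂(gegenbauerMeasure lam)
      ≤ ∫⁻ s, (lshift lam (cosh s) k (cosh r) * h s + lshift lam (cosh s) k (cosh x) * h s)
          ∂(gegenbauerMeasure lam) := by
        refine lintegral_mono_ae ?_
        filter_upwards [ae_gegenbauerMeasure_pos lam, ae_gegenbauerMeasure_ne lam r,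
          ae_gegenbauerMeasure_ne lam x] with s hs hsr hsx
        rw [← add_mul, lshift, lshift, ← lintegral_add_left (by fun_prop)]
        gcongr
        exact (enorm_truncWeight_sub_le hlam hβ.le hr hx hs.le hsr hsx 1 1).trans
          (lintegral_mono fun φ => enorm_sub_le.trans (add_le_add (hK _) (hK _)))
    _ = shiftConv lam k h (cosh r) + shiftConv lam k h (cosh x) :=
        lintegral_add_left (by fun_prop) _
    _ ≤ 2 * (majorantConst lam q * eLpNorm' h p (gegenbauerMeasure lam)) := by
        rw [two_mul]
        exact add_le_add (shiftConv_kernelMajorant_le hlam hpq hβq one_pos le_rfl hh hr)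
          (shiftConv_kernelMajorant_le hlam hpq hβq one_pos le_rfl hh hx)

/-- A bound, relative to the `L^p` norm, for the oscillation of `truncRiesz lam β (min d 1) g` at
distance `d`. -/
noncomputable def oscillationConst (lam β q : ℝ) : ℝ≥0∞ :=
  (ENNReal.ofReal (β * (2 * cosh 1) ^ (β + 2)) + 2) * majorantConst lam q

theorem enorm_truncRiesz_sub_le (hlam : 0 < lam) (hpq : p.HolderConjugate q)
    (hβq : β * q = 2 * lam + 1) (hd : 0 < d) (hg : StronglyMeasurable g)
    (hgp : eLpNorm' g p (gegenbauerMeasure lam) < ⊤) (hr : 0 ≤ r) (hx : 0 ≤ x)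
    (hrx : |r - x| ≤ d) :
    ‖truncRiesz lam β (min d 1) g (cosh r) - truncRiesz lam β (min d 1) g (cosh x)‖ₑ ≤
      oscillationConst lam β q * eLpNorm' g p (gegenbauerMeasure lam) := by
  have hR : 0 < min d 1 := lt_min hd one_pos
  have hint {y : ℝ} (hy : 0 ≤ y) :=
    integrable_truncWeight_smul hlam hpq hβq hR (min_le_right d 1) hg hgp hy
  rw [truncRiesz, truncRiesz, ← integral_sub (hint hr) (hint hx)]
  refine (enorm_integral_le_lintegral_enorm _).trans ?_
  simp only [← sub_smul, enorm_smul]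
  rw [oscillationConst, mul_assoc, add_mul, ← eLpNorm'_enorm]
  rcases le_total d 1 with hd1 | hd1
  · rw [min_eq_left hd1]
    exact (lintegral_enorm_truncWeight_sub_mul_le hlam hpq hβq hd hd1 hg.enorm hr hx hrx).trans
      le_self_add
  · rw [min_eq_right hd1]
    exact (lintegral_enorm_truncWeight_one_sub_mul_le hlam hpq hβq hg.enorm hr hx).trans
      le_add_self

theorem lintegral_enorm_truncWeight_zero_sub_smul_le (hlam : 0 < lam) (hβ : 0 ≤ β) (hr : 0 ≤ r)
    (R : ℝ) (g : ℝ → E) :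
    ∫⁻ s, ‖(truncWeight lam β 0 (cosh r) s - truncWeight lam β R (cosh r) s) • g s‖ₑ
        ∂(gegenbauerMeasure lam) ≤
      shiftConv lam (kernelGap β R) (fun s => ‖g s‖ₑ) (cosh r) := by
  refine lintegral_mono_ae ?_
  filter_upwards [ae_gegenbauerMeasure_pos lam, ae_gegenbauerMeasure_ne lam r] with s hs hsr
  rw [enorm_smul]
  gcongr
  exact enorm_truncWeight_sub_le hlam hβ hr hr hs.le hsr hsr 0 R

theorem integrable_truncWeight_zero_smul (hlam : 0 < lam) (hpq : p.HolderConjugate q)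
    (hβq : β * q = 2 * lam + 1) (hR : 0 < R) (hR1 : R ≤ 1) (hg : StronglyMeasurable g)
    (hgp : eLpNorm' g p (gegenbauerMeasure lam) < ⊤) (hr : 0 ≤ r)
    (hfin : shiftConv lam (kernelGap β R) (fun s => ‖g s‖ₑ) (cosh r) < ⊤) :
    Integrable (fun t => truncWeight lam β 0 (cosh r) t • g t) (gegenbauerMeasure lam) := by
  have hβ := kernelExponent_pos hlam hpq hβq
  have hsub : Integrable
      (fun t => (truncWeight lam β 0 (cosh r) t - truncWeight lam β R (cosh r) t) • g t)
      (gegenbauerMeasure lam) := by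
    refine ⟨?_, (lintegral_enorm_truncWeight_zero_sub_smul_le hlam hβ.le hr R g).trans_lt hfin⟩
    simp only [sub_smul]
    exact ((stronglyMeasurable_truncWeight_smul hlam hg β 0 _).sub
      (stronglyMeasurable_truncWeight_smul hlam hg β R _)).aestronglyMeasurable
  refine (hsub.add (integrable_truncWeight_smul hlam hpq hβq hR hR1 hg hgp hr)).congr
    (.of_forall fun t => ?_)
  simp only [Pi.add_apply, ← add_smul, sub_add_cancel]

theorem enorm_truncRiesz_zero_sub_le (hlam : 0 < lam) (hpq : p.HolderConjugate q)
    (hβq : β * q = 2 * lam + 1) (hR : 0 < R) (hR1 : R ≤ 1) (hg : StronglyMeasurable g)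
    (hgp : eLpNorm' g p (gegenbauerMeasure lam) < ⊤) (hr : 0 ≤ r) :
    ‖truncRiesz lam β 0 g (cosh r) - truncRiesz lam β R g (cosh r)‖ₑ ≤
      shiftConv lam (kernelGap β R) (fun s => ‖g s‖ₑ) (cosh r) := by
  rcases eq_or_ne (shiftConv lam (kernelGap β R) (fun s => ‖g s‖ₑ) (cosh r)) ⊤ with htop | hfin
  · exact htop ▸ le_top
  rw [truncRiesz, truncRiesz,
    ← integral_sub (integrable_truncWeight_zero_smul hlam hpq hβq hR hR1 hg hgp hr hfin.lt_top)
      (integrable_truncWeight_smul hlam hpq hβq hR hR1 hg hgp hr)]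
  refine (enorm_integral_le_lintegral_enorm _).trans ?_
  simp only [← sub_smul]
  exact lintegral_enorm_truncWeight_zero_sub_smul_le hlam
    (kernelExponent_pos hlam hpq hβq).le hr R g

/-- A bound for the `L^1` norm of `kernelGap β (min d 1)`, relative to `μ(H(0, d))^{1/p}`. -/
noncomputable def gapConst (lam p : ℝ) : ℝ≥0∞ :=
  ENNReal.ofReal (p / (2 * lam + 1)) *
    (ENNReal.ofReal (2 * lam + 1) * ENNReal.ofReal (cosh 1)) ^ (1 / p)

theorem lintegral_kernelGap_min_le (hlam : 0 < lam) (hpq : p.HolderConjugate q)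
    (hβq : β * q = 2 * lam + 1) (hd : 0 < d) :
    ∫⁻ t, kernelGap β (min d 1) (cosh t) ∂(gegenbauerMeasure lam) ≤
      gapConst lam p * gegenbauerMeasure lam (gegenbauerInterval 0 d) ^ (1 / p) := by
  set Q := 2 * lam + 1
  set R := min d 1
  have hQ : 0 < Q := by positivity
  have hp := hpq.pos
  have hR : 0 < R := lt_min hd one_pos
  have hsinh : 0 < sinh R := sinh_pos_iff.2 hR
  have hexp : Q - β = Q / p := sub_kernelExponent_eq_div hpq hβq
  have hβ : β < Q := by linarith [div_pos hQ hp]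
  have hball : ENNReal.ofReal (sinh R ^ Q) ≤ ENNReal.ofReal Q * ENNReal.ofReal (cosh 1) *
      gegenbauerMeasure lam (gegenbauerInterval 0 d) := by
    rw [← mul_div_cancel₀ (sinh R ^ Q) hQ.ne', ENNReal.ofReal_mul hQ.le, mul_assoc]
    gcongr
    exact le_gegenbauerMeasure_gegenbauerInterval_zero hlam hR (min_le_right _ _) (min_le_left _ _)
  calc ∫⁻ t, kernelGap β R (cosh t) ∂(gegenbauerMeasure lam)
      ≤ ENNReal.ofReal (sinh R ^ (Q - β) / (Q - β)) :=
        lintegral_kernelGap_le (kernelExponent_pos hlam hpq hβq).le hβ hR.le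
    _ = ENNReal.ofReal (p / Q) * ENNReal.ofReal (sinh R ^ Q) ^ (1 / p) := by
        rw [ENNReal.ofReal_rpow_of_nonneg (by positivity) (by positivity), ← rpow_mul hsinh.le,
          ← ENNReal.ofReal_mul (by positivity), hexp, mul_one_div, div_div_eq_mul_div,
          mul_div_assoc, mul_comm]
    _ ≤ ENNReal.ofReal (p / Q) * (ENNReal.ofReal Q * ENNReal.ofReal (cosh 1) *
          gegenbauerMeasure lam (gegenbauerInterval 0 d)) ^ (1 / p) := by gcongr
    _ = gapConst lam p * gegenbauerMeasure lam (gegenbauerInterval 0 d) ^ (1 / p) := by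
        rw [gapConst, ENNReal.mul_rpow_of_nonneg _ _ (by positivity), mul_assoc]

theorem setLIntegral_lshift_shiftConv_kernelGap_le (hlam : 0 < lam) (hpq : p.HolderConjugate q)
    (hβq : β * q = 2 * lam + 1) (hd : 0 < d) (hh : Measurable h) (hx : 0 ≤ x) :
    ∫⁻ t in gegenbauerInterval 0 d,
        lshift lam (cosh t) (shiftConv lam (kernelGap β (min d 1)) h) (cosh x)
          ∂(gegenbauerMeasure lam) ≤
      gapConst lam p * eLpNorm' h p (gegenbauerMeasure lam) *
        gegenbauerMeasure lam (gegenbauerInterval 0 d) := by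
  set N := eLpNorm' h p (gegenbauerMeasure lam)
  set m := gegenbauerMeasure lam (gegenbauerInterval 0 d)
  have hgap := measurable_kernelGap β (min d 1)
  calc ∫⁻ t in gegenbauerInterval 0 d,
        lshift lam (cosh t) (shiftConv lam (kernelGap β (min d 1)) h) (cosh x)
          ∂(gegenbauerMeasure lam)
      ≤ (∫⁻ t, kernelGap β (min d 1) (cosh t) ∂(gegenbauerMeasure lam)) * N * m ^ (1 / q) := by
        refine (setLIntegral_lshift_le hlam hpq (measurable_shiftConv hgap hh) hx _).trans ?_
        gcongr
        exact eLpNorm'_shiftConv_le hlam hpq hgap hh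
    _ ≤ gapConst lam p * m ^ (1 / p) * N * m ^ (1 / q) := by
        gcongr
        exact lintegral_kernelGap_min_le hlam hpq hβq hd
    _ = gapConst lam p * N * (m ^ (1 / p) * m ^ (1 / q)) := by ring
    _ = gapConst lam p * N * m := by
        rw [← ENNReal.rpow_add_of_nonneg _ _ hpq.one_div_nonneg hpq.symm.one_div_nonneg, one_div,
          one_div, hpq.inv_add_inv_eq_one, ENNReal.rpow_one]

theorem enorm_gegenbauerShift_sub_le [CompleteSpace E] (hlam : 0 < lam) {f : ℝ → E}
    (hf : StronglyMeasurable f) (u v : ℝ) (a : E) :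
    ‖gegenbauerShift lam u f v - a‖ₑ ≤ lshift lam u (fun y => ‖f y - a‖ₑ) v := by
  have := isProbabilityMeasure_angleMeasure hlam
  rcases eq_or_ne (lshift lam u (fun y => ‖f y - a‖ₑ) v) ⊤ with htop | hfin
  · exact htop ▸ le_top
  have hsub : Integrable (fun φ => f (shiftPoint v u φ) - a) (angleMeasure lam) :=
    ⟨((hf.comp_measurable (by fun_prop)).sub stronglyMeasurable_const).aestronglyMeasurable,
      hfin.lt_top⟩
  have hshift :
      gegenbauerShift lam u f v - a = ∫ φ, f (shiftPoint v u φ) - a ∂(angleMeasure lam) := by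
    have hf_int : Integrable (fun φ => f (shiftPoint v u φ)) (angleMeasure lam) :=
      (hsub.add (integrable_const a)).congr (.of_forall fun φ => sub_add_cancel _ _)
    rw [gegenbauerShift_eq_integral hlam, integral_sub hf_int (integrable_const a)]
    simp
  rw [hshift]
  exact enorm_integral_le_lintegral_enorm _

theorem setLIntegral_enorm_gegenbauerShift_truncRiesz_sub_le [CompleteSpace E] (hlam : 0 < lam)
    (hpq : p.HolderConjugate q) (hβq : β * q = 2 * lam + 1) (hd : 0 < d)
    (hg : StronglyMeasurable g) (hgp : eLpNorm' g p (gegenbauerMeasure lam) < ⊤) (hx : 0 ≤ x) :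
    ∫⁻ t in gegenbauerInterval 0 d,
        ‖gegenbauerShift lam (cosh t) (truncRiesz lam β 0 g) (cosh x) -
          truncRiesz lam β (min d 1) g (cosh x)‖ₑ ∂(gegenbauerMeasure lam) ≤
      (gapConst lam p + oscillationConst lam β q) * eLpNorm' g p (gegenbauerMeasure lam) *
        gegenbauerMeasure lam (gegenbauerInterval 0 d) := by
  have := isProbabilityMeasure_angleMeasure hlam
  set R := min d 1
  set gap := shiftConv lam (kernelGap β R) fun s => ‖g s‖ₑ
  set N := eLpNorm' g p (gegenbauerMeasure lam)
  set m := gegenbauerMeasure lam (gegenbauerInterval 0 d)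
  have hgap : Measurable gap := measurable_shiftConv (by fun_prop) hg.enorm
  have hdiff {r : ℝ} (hr : 0 ≤ r) (hrx : |r - x| ≤ d) :
      ‖truncRiesz lam β 0 g (cosh r) - truncRiesz lam β R g (cosh x)‖ₑ ≤
        gap (cosh r) + oscillationConst lam β q * N := by
    rw [← sub_add_sub_cancel _ (truncRiesz lam β R g (cosh r))]
    exact (enorm_add_le _ _).trans (add_le_add
      (enorm_truncRiesz_zero_sub_le hlam hpq hβq (lt_min hd one_pos) (min_le_right _ _) hg hgp hr)
      (enorm_truncRiesz_sub_le hlam hpq hβq hd hg hgp hr hx hrx))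
  calc ∫⁻ t in gegenbauerInterval 0 d,
        ‖gegenbauerShift lam (cosh t) (truncRiesz lam β 0 g) (cosh x) -
          truncRiesz lam β R g (cosh x)‖ₑ ∂(gegenbauerMeasure lam)
      ≤ ∫⁻ t in gegenbauerInterval 0 d,
          (lshift lam (cosh t) gap (cosh x) + oscillationConst lam β q * N)
            ∂(gegenbauerMeasure lam) := by
        refine setLIntegral_mono' (measurableSet_gegenbauerInterval 0 d) fun t ht => ?_
        have htd : t ≤ d := by simpa using ht.1.2.le
        refine (enorm_gegenbauerShift_sub_le hlam (stronglyMeasurable_truncRiesz hlam hg β 0)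
          _ _ _).trans ?_
        rw [← mul_one (_ * N), ← measure_univ (μ := angleMeasure lam), ← lintegral_const, lshift,
          lshift, ← lintegral_add_left (by fun_prop)]
        refine lintegral_mono fun φ => ?_
        rw [← cosh_shiftDist hx ht.2]
        exact hdiff (shiftDist_nonneg hx ht.2 φ) ((abs_shiftDist_sub_le hx ht.2 φ).trans htd)
    _ ≤ gapConst lam p * N * m + oscillationConst lam β q * N * m := by
        rw [lintegral_add_right _ measurable_const, setLIntegral_const]
        gcongr
        exact (setLIntegral_lshift_shiftConv_kernelGap_le hlam hpq hβq hd hg.enorm hx).trans_eq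
          (by rw [eLpNorm'_enorm])
    _ = (gapConst lam p + oscillationConst lam β q) * N * m := by ring

end Oscillation

section BMO

variable {lam β p q : ℝ} {F : ℝ → ℂ} {B : ℝ≥0∞}

theorem gegenbauerBMONorm_le (hlam : 0 < lam) (hF : StronglyMeasurable F)
    (hosc : ∀ x, 0 ≤ x → ∀ d, 0 < d → ∃ c, ∫⁻ t in gegenbauerInterval 0 d,
      ‖gegenbauerShift lam (cosh t) F (cosh x) - c‖ₑ ∂(gegenbauerMeasure lam) ≤
        B * gegenbauerMeasure lam (gegenbauerInterval 0 d)) :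
    gegenbauerBMONorm lam F ≤ 2 * B := by
  refine iSup_le fun x => iSup_le fun hx => iSup_le fun d => iSup_le fun hd => ?_
  obtain ⟨c, hc⟩ := hosc x hx d hd
  have := isFiniteMeasure_restrict_gegenbauerInterval_zero hlam d
  set m := gegenbauerMeasure lam (gegenbauerInterval 0 d)
  calc m⁻¹ * ∫⁻ t in gegenbauerInterval 0 d,
        ‖gegenbauerShift lam (cosh t) F (cosh x) - gegenbauerMean lam F x d‖ₑ
          ∂(gegenbauerMeasure lam)
      ≤ m⁻¹ * (2 * (B * m)) := by
        gcongr
        exact (lintegral_enorm_sub_average_le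
          (stronglyMeasurable_gegenbauerShift_cosh hlam hF _).aestronglyMeasurable c).trans
            (by gcongr)
    _ = 2 * B * (m⁻¹ * m) := by ring
    _ ≤ 2 * B * 1 := by
        gcongr
        exact ENNReal.inv_mul_le_one m
    _ = 2 * B := mul_one _

theorem locallyIntegrableOn_comp_cosh (hlam : 0 < lam) (hF : StronglyMeasurable F)
    (hosc : ∀ d, 0 < d → ∃ c, ∫⁻ t in gegenbauerInterval 0 d, ‖F (cosh t) - c‖ₑ
      ∂(gegenbauerMeasure lam) < ⊤) :
    LocallyIntegrableOn (fun t => F (cosh t)) (Ici 0) (gegenbauerMeasure lam) := by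
  intro x (hx : 0 ≤ x)
  refine ⟨gegenbauerInterval 0 (x + 1), ?_, ?_⟩
  · rw [gegenbauerInterval, inter_comm]
    exact inter_mem_nhdsWithin _ (Ioo_mem_nhds (by linarith) (by linarith))
  · obtain ⟨c, hc⟩ := hosc (x + 1) (by linarith)
    have := isFiniteMeasure_restrict_gegenbauerInterval_zero hlam (x + 1)
    have hsub : IntegrableOn (fun t => F (cosh t) - c) (gegenbauerInterval 0 (x + 1))
        (gegenbauerMeasure lam) :=
      ⟨((hF.comp_measurable measurable_cosh).sub stronglyMeasurable_const).aestronglyMeasurable,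
        hc⟩
    exact (hsub.add (integrable_const c)).congr (.of_forall fun t => sub_add_cancel _ _)

theorem memGegenbauerBMO_of_setLIntegral_le (hlam : 0 < lam) (hF : StronglyMeasurable F)
    (hB : B < ⊤) (hosc : ∀ x, 0 ≤ x → ∀ d, 0 < d → ∃ c, ∫⁻ t in gegenbauerInterval 0 d,
      ‖gegenbauerShift lam (cosh t) F (cosh x) - c‖ₑ ∂(gegenbauerMeasure lam) ≤
        B * gegenbauerMeasure lam (gegenbauerInterval 0 d)) :
    MemGegenbauerBMO lam F := by
  refine ⟨locallyIntegrableOn_comp_cosh hlam hF fun d hd => ?_,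
    (gegenbauerBMONorm_le hlam hF hosc).trans_lt (ENNReal.mul_lt_top ENNReal.ofNat_lt_top hB)⟩
  have := isProbabilityMeasure_angleMeasure hlam
  have hfin := (isFiniteMeasure_restrict.1
    (isFiniteMeasure_restrict_gegenbauerInterval_zero hlam d)).lt_top
  obtain ⟨c, hc⟩ := hosc 0 le_rfl d hd
  refine ⟨c, lt_of_le_of_lt ?_ (ENNReal.mul_lt_top hB hfin)⟩
  simpa [gegenbauerShift_eq_integral hlam, shiftPoint_one_left] using hc

theorem eLpNorm_ofReal {X E : Type*} [MeasurableSpace X] [NormedAddCommGroup E] (hp : 0 < p)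
    (f : X → E) (μ : Measure X) : eLpNorm f (ENNReal.ofReal p) μ = eLpNorm' f p μ := by
  rw [eLpNorm_eq_eLpNorm' (by simpa using hp) ENNReal.ofReal_ne_top, ENNReal.toReal_ofReal hp.le]

variable {E : Type*} [NormedAddCommGroup E] [NormedSpace ℝ E] {g : ℝ → E}

theorem ae_shiftConv_kernelGap_lt_top {h : ℝ → ℝ≥0∞} (hlam : 0 < lam) (hpq : p.HolderConjugate q)
    (hβq : β * q = 2 * lam + 1) (hh : Measurable h)
    (hhp : eLpNorm' h p (gegenbauerMeasure lam) < ⊤) :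
    ∀ᵐ x ∂(gegenbauerMeasure lam), shiftConv lam (kernelGap β 1) h (cosh x) < ⊤ := by
  have hp := hpq.pos
  have hβ : β < 2 * lam + 1 := by
    linarith [sub_kernelExponent_eq_div hpq hβq, div_pos (by linarith : 0 < 2 * lam + 1) hp]
  have hgap : ∫⁻ t, kernelGap β 1 (cosh t) ∂(gegenbauerMeasure lam) < ⊤ :=
    (lintegral_kernelGap_le (kernelExponent_pos hlam hpq hβq).le hβ zero_le_one).trans_lt
      ENNReal.ofReal_lt_top
  have hYoung := (eLpNorm'_shiftConv_le hlam hpq (measurable_kernelGap β 1) hh).trans_lt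
    (ENNReal.mul_lt_top hgap hhp)
  have hmeas : Measurable fun x => shiftConv lam (kernelGap β 1) h (cosh x) :=
    (measurable_shiftConv (measurable_kernelGap β 1) hh).comp measurable_cosh
  filter_upwards [ae_lt_top (hmeas.enorm.pow_const p)
    (lintegral_rpow_enorm_lt_top_of_eLpNorm'_lt_top hp hYoung).ne] with x hx
  exact (ENNReal.rpow_lt_top_iff_of_pos hp).1 hx

theorem ae_integrable_truncWeight_zero_smul (hlam : 0 < lam) (hpq : p.HolderConjugate q)
    (hβq : β * q = 2 * lam + 1) (hg : StronglyMeasurable g)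
    (hgp : eLpNorm' g p (gegenbauerMeasure lam) < ⊤) :
    ∀ᵐ x ∂(gegenbauerMeasure lam),
      Integrable (fun t => truncWeight lam β 0 (cosh x) t • g t) (gegenbauerMeasure lam) := by
  filter_upwards [ae_gegenbauerMeasure_pos lam,
    ae_shiftConv_kernelGap_lt_top hlam hpq hβq hg.enorm (by rwa [eLpNorm'_enorm])] with x hx hfin
  exact integrable_truncWeight_zero_smul hlam hpq hβq one_pos le_rfl hg hgp hx.le hfin

theorem gapConst_add_oscillationConst_lt_top (hpq : p.HolderConjugate q) (lam β : ℝ) :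
    gapConst lam p + oscillationConst lam β q < ⊤ := by
  refine ENNReal.add_lt_top.2 ⟨ENNReal.mul_lt_top ENNReal.ofReal_lt_top
    (ENNReal.rpow_lt_top_of_nonneg hpq.one_div_nonneg (by finiteness)), ?_⟩
  exact ENNReal.mul_lt_top (by finiteness) (majorantConst_ne_top hpq.symm.nonneg lam).lt_top

theorem gegenbauerBMONorm_truncRiesz_le {g : ℝ → ℂ} (hlam : 0 < lam) (hpq : p.HolderConjugate q)
    (hβq : β * q = 2 * lam + 1) (hg : StronglyMeasurable g)
    (hgp : eLpNorm' g p (gegenbauerMeasure lam) < ⊤) :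
    gegenbauerBMONorm lam (truncRiesz lam β 0 g) ≤
      2 * (gapConst lam p + oscillationConst lam β q) * eLpNorm' g p (gegenbauerMeasure lam) := by
  rw [mul_assoc]
  exact gegenbauerBMONorm_le hlam (stronglyMeasurable_truncRiesz hlam hg β 0) fun _ hx _ hd =>
    ⟨_, setLIntegral_enorm_gegenbauerShift_truncRiesz_sub_le hlam hpq hβq hd hg hgp hx⟩

theorem memGegenbauerBMO_truncRiesz {g : ℝ → ℂ} (hlam : 0 < lam) (hpq : p.HolderConjugate q)
    (hβq : β * q = 2 * lam + 1) (hg : StronglyMeasurable g)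
    (hgp : eLpNorm' g p (gegenbauerMeasure lam) < ⊤) :
    MemGegenbauerBMO lam (truncRiesz lam β 0 g) :=
  memGegenbauerBMO_of_setLIntegral_le hlam (stronglyMeasurable_truncRiesz hlam hg β 0)
    (ENNReal.mul_lt_top (gapConst_add_oscillationConst_lt_top hpq lam β) hgp) fun _ hx _ hd =>
      ⟨_, setLIntegral_enorm_gegenbauerShift_truncRiesz_sub_le hlam hpq hβq hd hg hgp hx⟩

end BMO

end Gegenbauer

open Gegenbauer

theorem theorem4 (lam α p : ℝ) (hlam : 0 < lam) (hα : 0 < α) (hα' : α < 2 * lam + 1)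
    (hp : p * α = 2 * lam + 1) :
    ∃ c : ℝ, 0 < c ∧ ∀ f : ℝ → ℂ,
      MemLp (fun t => f (Real.cosh t)) (ENNReal.ofReal p) (gegenbauerMeasure lam) →
        (∀ᵐ x ∂(gegenbauerMeasure lam),
          Integrable (modifiedRieszGegenbauerIntegrand lam α f (Real.cosh x))
            (gegenbauerMeasure lam)) ∧
        MemGegenbauerBMO lam (modifiedRieszGegenbauer lam α f) ∧
        gegenbauerBMONorm lam (modifiedRieszGegenbauer lam α f) ≤
          ENNReal.ofReal c *
            eLpNorm (fun t => f (Real.cosh t)) (ENNReal.ofReal p) (gegenbauerMeasure lam) := by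
  have hp1 : 1 < p := lt_of_mul_lt_mul_right (by linarith) hα.le
  have hpq := Real.HolderConjugate.conjExponent hp1
  have hβq : (2 * lam + 1 - α) * p.conjExponent = 2 * lam + 1 := by
    rw [← hp, ← sub_one_mul, mul_right_comm, hpq.sub_one_mul_conj]
  set C := 2 * (gapConst lam p + oscillationConst lam (2 * lam + 1 - α) p.conjExponent)
  have hC : C < ⊤ := ENNReal.mul_lt_top ENNReal.ofNat_lt_top
    (gapConst_add_oscillationConst_lt_top hpq _ _)
  refine ⟨C.toReal + 1, by positivity, fun f hf => ?_⟩
  obtain ⟨g, hg, hfg⟩ := hf.1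
  have hnorm := (eLpNorm_ofReal hpq.pos _ _).trans (eLpNorm'_congr_ae hfg)
  have hgp := hnorm ▸ hf.2
  rw [hnorm, modifiedRieszGegenbauer_eq_truncRiesz hfg]
  refine ⟨(ae_integrable_truncWeight_zero_smul hlam hpq hβq hg hgp).mono fun x hx =>
      hx.congr (modifiedRieszGegenbauerIntegrand_ae_eq hfg α _).symm,
    memGegenbauerBMO_truncRiesz hlam hpq hβq hg hgp,
    (gegenbauerBMONorm_truncRiesz_le hlam hpq hβq hg hgp).trans ?_⟩
  gcongr
  exact (ENNReal.le_ofReal_iff_toReal_le hC.ne (by positivity)).2 (lt_add_one _).le
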